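/- **Setting.** Let $V\ge 1$ and $P=\{1,\dots,V\}$. There are $n^s$ sellers with valuations $v^s_i\in P$ and $n^b$ buyers with valuations $v^b_j\in P$, each trading one share. For a price $p\in P$ and reports $r^s\in P^{n^s}$, $r^b\in P^{n^b}$ put $s(p)=\#\{i: r^s_i\le p\}$, $b(p)=\#\{j: r^b_j\ge p\}$, $\Pi(p,r^s,r^b)=\min\{s(p),b(p)\}$, and let $\mathrm{OPT}=\max_{p\in P}\Pi(p,v^s,v^b)$. **Mechanism $\mathcal M_1$** (privacy level $\epsilon>0$, confidence level $\alpha\in(0,1)$), run on reports $(r^s,r^b)$: draw $p\in P$ with probability proportional to $\exp(\epsilon\,\Pi(p,r^s,r^b)/2)$; put $\hat s=s(p)+Z^s$ and $\hat b=b(p)+Z^b$ with independent centred Laplace variables $Z^s,Z^b$ of scale $1/\epsilon$; with $x_+=\max(x,0)$ put $$q^s=\min\Big\{1,\frac{\hat b_+}{(\hat s-\ln(1/\alpha)/\epsilon)_+}\Big\},\qquad q^b=\min\Big\{1,\frac{\hat s_+}{(\hat b-\ln(1/\alpha)/\epsilon)_+}\Big\},$$ where $x/0=+\infty$ for $x>0$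 and $0/0$ is read as an arbitrary fixed number $c\in[0,1]$; finally, with independent coins, allocate a trade ($a^s_i=1$) to each seller with $r^s_i\le p$ with probability $q^s$ and ($a^b_j=1$) to each buyer with $r^b_j\ge p$ with probability $q^b$; all other allocations are $0$. The number of shares cleared by the mechanism is $\min\{\sum_i a^s_i,\sum_j a^b_j\}$. **Social Exponential Weights** (learning rate $\eta>0$, fake utility $\xi>0$). Buyer $j$ starts with the uniform weights $w^b_{j,1}(k)=1/v^b_j$ on $k=1,\dots,v^b_j$, and seller $i$ with the uniform weights on $k=v^s_i,\dots,V$. In round $t=1,2,\dots$ all agents independently draw bids $r^b_{j,t}\sim w^b_{j,t}$, $r^s_{i,t}\sim w^s_{i,t}$; $\mathcal M_1$ is run on these bids with fresh randomness, and gives a price $p_t$, biases $q^s_t,q^b_t$ and allocations $a^s_{i,t},a^b_{j,t}$; each buyer then sets $$w^b_{j,t+1}(k)=\frac{\exp(\eta\mu^b_{j,t}(k))}{\sum_l w^b_{j,t}(l)\exp(\eta\mu^b_{j,t}(l))}\,w^b_{j,t}(k),\qquad \mu^b_{j,t}(k)=\begin{cases}q^b_t(v^b_j-p_t)\mathbf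 1[k\ge p_t]&\text{if } v^b_j\ne p_t,\\ q^b_t\,\xi\,\mathbf 1[k=v^b_j]&\text{if } v^b_j=p_t,\end{cases}$$ and each seller updates in the same way with $\mu^s_{i,t}(k)=q^s_t(p_t-v^s_i)\mathbf 1[k\le p_t]$ if $v^s_i\neq p_t$ and $\mu^s_{i,t}(k)=q^s_t\,\xi\,\mathbf 1[k=v^s_i]$ if $v^s_i=p_t$. **Theorem.** There is an integer $N(\alpha)\ge 1$ such that for every $t\ge N(\alpha)$, with $$B=\mathrm{OPT}-\frac{2\ln(V/\alpha)}{\epsilon}-\frac{2\ln(1/\alpha)}{\epsilon}-\sqrt{6\Big(\mathrm{OPT}+\frac{\ln(1/\alpha)}{\epsilon}\Big)\ln(1/\alpha)},$$ one has $$\Pr\big[\Pi(p_t,r^s_t,r^b_t)\ge B\big]\ge 1-9\alpha\qquad\text{and}\qquad \Pr\Big[\min\Big\{\sum_i a^s_{i,t},\sum_j a^b_{j,t}\Big\}\ge B\Big]\ge 1-9\alpha,$$ where the probabilities are over the randomness of both the mechanism and the agents' bids in all rounds. -/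

import Mathlib

open MeasureTheory

noncomputable section

namespace CallAuction

/-- The set `P = {1, …, V}` of prices, valuations and bids. -/
abbrev Price (V : ℕ) : Type := ↥(Finset.Icc 1 V)

/-! ### Shares that can be cleared at a uniform price -/

/-- Number of sellers whose report is at most `p`. -/
def supply {V nS : ℕ} (rS : Fin nS → Price V) (p : Price V) : ℕ :=
  (Finset.univ.filter fun i => rS i ≤ p).card

/-- Number of buyers whose report is at least `p`. -/
def demand {V nB : ℕ} (rB : Fin nB → Price V) (p : Price V) : ℕ :=
  (Finset.univ.filter fun j => p ≤ rB j).card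

/-- `Π(p, rS, rB)`: the number of trades possible at price `p` given the reports. -/
def clearable {V nS nB : ℕ} (p : Price V) (rS : Fin nS → Price V) (rB : Fin nB → Price V) : ℕ :=
  min (supply rS p) (demand rB p)

/-- `OPT`: the maximum of `Π(p, vS, vB)` over the prices `p ∈ P`. -/
def opt {V nS nB : ℕ} (vS : Fin nS → Price V) (vB : Fin nB → Price V) : ℕ :=
  Finset.univ.sup fun p => clearable p vS vB

/-! ### Elementary probability laws -/

/-- The law on a finite type that gives mass `w k` to each point `k`. -/
def finiteLaw {K : Type*} [Fintype K] [MeasurableSpace K] (w : K → ℝ) : Measure K :=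
  ∑ k, ENNReal.ofReal (w k) • Measure.dirac k

/-- The Bernoulli law with success probability `q`. -/
def bernoulliLaw (q : ℝ) : Measure Bool :=
  finiteLaw fun x => if x = true then q else 1 - q

/-- The centred Laplace law with scale `σ`. -/
def laplaceLaw (σ : ℝ) : Measure ℝ :=
  volume.withDensity fun x => ENNReal.ofReal (1 / (2 * σ) * Real.exp (-|x| / σ))

/-! ### One round of the private call auction with coin flips -/

/-- `min {1, x₊ / y₊}`, where `x / 0` is `+∞` for `x > 0` and `0 / 0` is read as `c`. -/
def coinBias (c x y : ℝ) : ℝ :=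
  if max y 0 = 0 then (if max x 0 = 0 then c else 1) else min 1 (max x 0 / max y 0)

/-- What happens in one round: the sellers' and the buyers' reports, the price, the noise added
to the counts of willing sellers and of willing buyers, and the coins of all sellers and buyers. -/
abbrev Round (V nS nB : ℕ) : Type :=
  ((Fin nS → Price V) × (Fin nB → Price V)) × Price V × (ℝ × ℝ) × ((Fin nS → Bool) × (Fin nB → Bool))

/-- Parameters: privacy level `ε`, confidence level `α`, learning rate `η`, fake utility `ξ`, and
the value `c` given to `0 / 0` in the bias of the coins. -/
structure Params where
  ε : ℝ
  α : ℝ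
  η : ℝ
  ξ : ℝ
  c : ℝ

/-- The bias `qS` of the sellers' coins, given reports, price and the two noise terms. -/
def sellerBias {V nS nB : ℕ} (θ : Params) (rS : Fin nS → Price V) (rB : Fin nB → Price V)
    (p : Price V) (z : ℝ × ℝ) : ℝ :=
  coinBias θ.c (demand rB p + z.2) (supply rS p + z.1 - Real.log (1 / θ.α) / θ.ε)

/-- The bias `qB` of the buyers' coins, given reports, price and the two noise terms. -/
def buyerBias {V nS nB : ℕ} (θ : Params) (rS : Fin nS → Price V) (rB : Fin nB → Price V)
    (p : Price V) (z : ℝ × ℝ) : ℝ :=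
  coinBias θ.c (supply rS p + z.1) (demand rB p + z.2 - Real.log (1 / θ.α) / θ.ε)

/-- Exponential mechanism: `p` is drawn with probability proportional to
`exp (ε Π(p, rS, rB) / 2)`. -/
def priceLaw {V nS nB : ℕ} (θ : Params) (rS : Fin nS → Price V) (rB : Fin nB → Price V) :
    Measure (Price V) :=
  finiteLaw fun p => Real.exp (θ.ε * clearable p rS rB / 2) /
    ∑ p' : Price V, Real.exp (θ.ε * clearable p' rS rB / 2)

/-- The joint law of the coins: independent, of bias `qS` for sellers and `qB` for buyers. -/
def coinLaw (nS nB : ℕ) (qS qB : ℝ) : Measure ((Fin nS → Bool) × (Fin nB → Bool)) :=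
  (Measure.pi fun _ => bernoulliLaw qS).prod (Measure.pi fun _ => bernoulliLaw qB)

/-- The private mechanism run on the reports `rS`, `rB`: a price is drawn by the exponential
mechanism, the counts of willing sellers and buyers are perturbed by independent Laplace noise of
scale `1 / ε`, and coins are flipped with the resulting biases. -/
def mechanismLaw {V nS nB : ℕ} (θ : Params)
    (r : (Fin nS → Price V) × (Fin nB → Price V)) : Measure (Round V nS nB) :=
  (priceLaw θ r.1 r.2).bind fun p =>
    ((laplaceLaw (1 / θ.ε)).prod (laplaceLaw (1 / θ.ε))).bind fun z =>
      (coinLaw nS nB (sellerBias θ r.1 r.2 p z) (buyerBias θ r.1 r.2 p z)).map fun x => (r, p, z, x)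

/-- `Π(p_t, rS_t, rB_t)`: the shares that can be cleared at the price of the round, given the
reports of the round. -/
def Round.clearable {V nS nB : ℕ} (o : Round V nS nB) : ℕ :=
  CallAuction.clearable o.2.1 o.1.1 o.1.2

/-- Seller `i` is allocated a trade: he is willing to sell and his coin succeeds. -/
def Round.sellerAllocated {V nS nB : ℕ} (o : Round V nS nB) (i : Fin nS) : Prop :=
  o.1.1 i ≤ o.2.1 ∧ o.2.2.2.1 i = true

/-- Buyer `j` is allocated a trade: he is willing to buy and his coin succeeds. -/
def Round.buyerAllocated {V nS nB : ℕ} (o : Round V nS nB) (j : Fin nB) : Prop :=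
  o.2.1 ≤ o.1.2 j ∧ o.2.2.2.2 j = true

open Classical in
/-- The payoff of the mechanism in the round: the minimum of the numbers of allocated sellers and
allocated buyers. -/
def Round.payoff {V nS nB : ℕ} (o : Round V nS nB) : ℕ :=
  min (Finset.univ.filter fun i => o.sellerAllocated i).card
    (Finset.univ.filter fun j => o.buyerAllocated j).card

/-! ### Social Exponential Weights -/

/-- The weights of all sellers and of all buyers over their possible bids. -/
abbrev Weights (V nS nB : ℕ) : Type := (Fin nS → Price V → ℝ) × (Fin nB → Price V → ℝ)

/-- Initial weights: sellers are uniform on `{v, …, V}`, buyers on `{1, …, v}`. -/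
def initWeights {V nS nB : ℕ} (vS : Fin nS → Price V) (vB : Fin nB → Price V) : Weights V nS nB :=
  (fun i k => if vS i ≤ k then 1 / ((V : ℝ) - ((vS i : ℕ) : ℝ) + 1) else 0,
   fun j k => if k ≤ vB j then 1 / ((vB j : ℕ) : ℝ) else 0)

/-- Utility that a seller of valuation `v` credits to the bid `k` at price `p` and bias `q`. -/
def sellerUtility {V : ℕ} (ξ q : ℝ) (v p k : Price V) : ℝ :=
  if v ≠ p then q * (((p : ℕ) : ℝ) - ((v : ℕ) : ℝ)) * (if k ≤ p then 1 else 0)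
  else q * ξ * (if k = v then 1 else 0)

/-- Utility that a buyer of valuation `v` credits to the bid `k` at price `p` and bias `q`. -/
def buyerUtility {V : ℕ} (ξ q : ℝ) (v p k : Price V) : ℝ :=
  if v ≠ p then q * (((v : ℕ) : ℝ) - ((p : ℕ) : ℝ)) * (if p ≤ k then 1 else 0)
  else q * ξ * (if k = v then 1 else 0)

/-- Multiplicative update of the weights `w` with utilities `μ` and learning rate `η`. Bids of
weight zero (those on the wrong side of the valuation) keep weight zero. -/
def expUpdate {K : Type*} [Fintype K] (η : ℝ) (μ w : K → ℝ) (k : K) : ℝ :=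
  Real.exp (η * μ k) / (∑ l, w l * Real.exp (η * μ l)) * w k

/-- The weights of all agents after a round `o` that was played with weights `w`. -/
def updateWeights {V nS nB : ℕ} (θ : Params) (vS : Fin nS → Price V) (vB : Fin nB → Price V)
    (w : Weights V nS nB) (o : Round V nS nB) : Weights V nS nB :=
  (fun i => expUpdate θ.η
      (sellerUtility θ.ξ (sellerBias θ o.1.1 o.1.2 o.2.1 o.2.2.1) (vS i) o.2.1) (w.1 i),
   fun j => expUpdate θ.η
      (buyerUtility θ.ξ (buyerBias θ o.1.1 o.1.2 o.2.1 o.2.2.1) (vB j) o.2.1) (w.2 j))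

/-- The joint law of the bids: every agent draws independently from his weights. -/
def bidLaw {V nS nB : ℕ} (w : Weights V nS nB) :
    Measure ((Fin nS → Price V) × (Fin nB → Price V)) :=
  (Measure.pi fun i => finiteLaw (w.1 i)).prod (Measure.pi fun j => finiteLaw (w.2 j))

/-- The law of a round in which the agents bid according to the weights `w`. -/
def roundLaw {V nS nB : ℕ} (θ : Params) (w : Weights V nS nB) : Measure (Round V nS nB) :=
  (bidLaw w).bind (mechanismLaw θ)

/-! ### The repeated auction -/

/-- The law of the weights after `n` rounds. -/
def weightsLaw {V nS nB : ℕ} (θ : Params) (vS : Fin nS → Price V) (vB : Fin nB → Price V) :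
    ℕ → Measure (Weights V nS nB)
  | 0 => Measure.dirac (initWeights vS vB)
  | n + 1 => (weightsLaw θ vS vB n).bind fun w => (roundLaw θ w).map (updateWeights θ vS vB w)

/-- The law of round `t`, for `t = 1, 2, …`, when the agents with valuations `vS`, `vB` play the
repeated private call auction by Social Exponential Weights. -/
def repeatedLaw {V nS nB : ℕ} (θ : Params) (vS : Fin nS → Price V) (vB : Fin nB → Price V)
    (t : ℕ) : Measure (Round V nS nB) :=
  (weightsLaw θ vS vB (t - 1)).bind (roundLaw θ)

end CallAuction

end

/-!
Every agent is eventually truthful, and one run of the mechanism on truthful reports is accurate.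

**Learning.** For an agent whose valuation is `v`, follow the odds `(1 - w v) / w v` against the
truthful bid. At every price the truthful bid is credited at least as much as any other bid of
positive weight, so an update never increases the odds (`IsBidWeight.odds_expUpdate_le`). If the
price equals `v` and the coin bias is `1`, the fake utility `ξ` is credited to the truthful bid
only, and the odds shrink by the factor `exp (-η ξ)`. Whatever the reports, this event has positive
probability: the exponential mechanism charges every price, and the bias is `1` when the Laplace
noise is low enough on one side and positive on the other (`mechanismLaw_pos`). As there are
finitely many report vectors, the probability is bounded below by some `δ > 0`, so the expected odds
decay geometrically (`tendsto_lintegral_weightsLaw`). The probability that somebody misreports is at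
most the sum of the expected odds (`IsBidProfile.bidLaw_ne_le`), hence eventually below `α`.

**Accuracy.** On fixed reports, let `L = log (1 / α) / ε`. The exponential mechanism loses more than
`2 log (V / α) / ε` with probability at most `α` (`priceLaw_lt_le`), and some noise term exceeds `L`
in absolute value with probability at most `2 α` (`noise_abs_gt_le`). Otherwise the expected number
of successful coins on either side is at least `m = Π(p) - L`, because the number of willing agents
dominates the denominator of the bias (`min_le_mul_coinBias`). Chernoff's bound
(`chernoff_lower`) then costs at most `α` per side, and the square root in the error makes its
exponent large enough.

The total failure probability is at most `6 α`. The allocated agents are among the willing ones, so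
the bound on the cleared shares implies the bound on the shares that can be cleared.
-/

noncomputable section

namespace CallAuction

open scoped ENNReal Topology
open Filter

/-! ### Two-stage laws and laws on finite types -/

/-- If a first stage leaves `G` with probability at most `a`, and from every outcome in `G` the
second stage hits `A` with probability at most `b`, then the two stages hit `A` with probability
at most `a + b`. -/
theorem bind_apply_le_add {X Y : Type*} [MeasurableSpace X] [MeasurableSpace Y] {μ : Measure X}
    [IsProbabilityMeasure μ] {κ : X → Measure Y} (hκ : Measurable κ)
    (h1 : ∀ x, κ x Set.univ ≤ 1) {G : Set X} (hG : MeasurableSet G) {a b : ℝ≥0∞}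
    (hμ : μ Gᶜ ≤ a) {A : Set Y} (hA : MeasurableSet A) (hb : ∀ x ∈ G, κ x A ≤ b) :
    μ.bind κ A ≤ a + b := by
  rw [Measure.bind_apply hA hκ.aemeasurable]
  calc ∫⁻ x, κ x A ∂μ ≤ ∫⁻ x, (Gᶜ.indicator 1 x + b) ∂μ := by
        refine lintegral_mono fun x => ?_
        by_cases hx : x ∈ G
        · simpa [hx] using hb x hx
        · simpa [hx] using
            ((measure_mono (Set.subset_univ A)).trans (h1 x)).trans (le_add_right le_rfl)
    _ = μ Gᶜ + b := by
        rw [lintegral_add_right _ measurable_const, lintegral_indicator_one hG.compl]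
        simp
    _ ≤ a + b := by gcongr

theorem isProbabilityMeasure_bind {X Y : Type*} [MeasurableSpace X] [MeasurableSpace Y]
    {μ : Measure X} [IsProbabilityMeasure μ] {κ : X → Measure Y} (hκ : Measurable κ)
    (h1 : ∀ᵐ x ∂μ, IsProbabilityMeasure (κ x)) : IsProbabilityMeasure (μ.bind κ) := by
  constructor
  rw [Measure.bind_apply MeasurableSet.univ hκ.aemeasurable]
  rw [lintegral_congr_ae (g := fun _ => 1) (h1.mono fun x hx => hx.measure_univ)]
  simp

section Fintype

variable {X Y Z : Type*} [MeasurableSpace X] [MeasurableSpace Y] [MeasurableSpace Z] [Fintype Y]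
  [MeasurableSingletonClass Y]

theorem measure_eq_sum_singleton (μ : Measure Y) (s : Set Y) :
    μ s = ∑ y, s.indicator 1 y * μ {y} := by
  rw [← lintegral_fintype, lintegral_indicator_one s.toFinite.measurableSet]

theorem measurable_of_measurable_singleton {κ : X → Measure Y}
    (h : ∀ y, Measurable fun x => κ x {y}) : Measurable κ := by
  refine Measure.measurable_of_measurable_coe _ fun s _ => ?_
  simp_rw [measure_eq_sum_singleton _ s]
  exact Finset.measurable_sum _ fun y _ => (h y).const_mul _

/-- A measurable family of laws on a finite type is pushed forward measurably by maps that depend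
on the parameter. -/
theorem measurable_map_prodMk {κ : X → Measure Y} (hκ : Measurable κ) {f : X → Y → Z}
    (hf : Measurable f.uncurry) : Measurable fun x => (κ x).map (f x) := by
  refine Measure.measurable_of_measurable_coe _ fun s hs => ?_
  have hfx : ∀ x, Measurable (f x) := fun x => hf.comp measurable_prodMk_left
  simp_rw [Measure.map_apply (hfx _) hs, measure_eq_sum_singleton _ (f _ ⁻¹' s)]
  refine Finset.measurable_sum _ fun y _ => Measurable.mul ?_
    ((Measure.measurable_coe (measurableSet_singleton y)).comp hκ)
  have hy : Measurable fun x => f x y := hf.comp (measurable_id.prodMk measurable_const)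
  exact (measurable_one.indicator hs).comp hy

end Fintype

section FiniteLaw

variable {K : Type*} [Fintype K] [MeasurableSpace K]

instance (w : K → ℝ) : IsFiniteMeasure (finiteLaw w) := by
  constructor
  simp [finiteLaw]

variable [MeasurableSingletonClass K]

theorem lintegral_finiteLaw (w : K → ℝ) (f : K → ℝ≥0∞) :
    ∫⁻ k, f k ∂finiteLaw w = ∑ k, ENNReal.ofReal (w k) * f k := by
  simp [finiteLaw, lintegral_finsetSum_measure, lintegral_smul_measure]

theorem finiteLaw_apply (w : K → ℝ) (s : Set K) :
    finiteLaw w s = ∑ k, ENNReal.ofReal (w k) * s.indicator 1 k := by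
  rw [← lintegral_finiteLaw, lintegral_indicator_one s.toFinite.measurableSet]

theorem finiteLaw_singleton (w : K → ℝ) (k : K) : finiteLaw w {k} = ENNReal.ofReal (w k) := by
  classical
  rw [finiteLaw_apply, Finset.sum_eq_single k] <;> simp +contextual

theorem isProbabilityMeasure_finiteLaw {w : K → ℝ} (h0 : ∀ k, 0 ≤ w k) (h1 : ∑ k, w k = 1) :
    IsProbabilityMeasure (finiteLaw w) := by
  constructor
  rw [finiteLaw_apply]
  simp [← ENNReal.ofReal_sum_of_nonneg fun k _ => h0 k, h1]

theorem finiteLaw_compl_singleton {w : K → ℝ} (h0 : ∀ k, 0 ≤ w k) (h1 : ∑ k, w k = 1) (v : K) :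
    finiteLaw w {v}ᶜ = ENNReal.ofReal (1 - w v) := by
  have := isProbabilityMeasure_finiteLaw h0 h1
  rw [prob_compl_eq_one_sub (measurableSet_singleton v), finiteLaw_singleton,
    ENNReal.ofReal_sub _ (h0 v), ENNReal.ofReal_one]

end FiniteLaw

/-! ### Exponential weights with a dominant bid -/

section ExpUpdate

variable {K : Type*} [Fintype K]

/-- `w` is a probability vector supported in the set `S` of admissible bids and giving positive
weight to the truthful bid `v`. -/
structure IsBidWeight (S : Set K) (v : K) (w : K → ℝ) : Prop where
  nonneg : ∀ k, 0 ≤ w k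
  sum_eq : ∑ k, w k = 1
  eq_zero : ∀ k, k ∉ S → w k = 0
  pos : 0 < w v

/-- The odds against the bid `v` under the weights `w`. -/
def odds (v : K) (w : K → ℝ) : ℝ := (1 - w v) / w v

theorem measurableSet_isBidWeight (S : Set K) (v : K) :
    MeasurableSet {w : K → ℝ | IsBidWeight S v w} := by
  have : {w : K → ℝ | IsBidWeight S v w} =
      ((⋂ k, {w | 0 ≤ w k}) ∩ {w | ∑ k, w k = 1}) ∩
        ((⋂ k, ⋂ (_ : k ∉ S), {w | w k = 0}) ∩ {w | 0 < w v}) := by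
    ext w
    simp only [Set.mem_inter_iff, Set.mem_iInter, Set.mem_ofPred_eq]
    exact ⟨fun h => ⟨⟨h.1, h.2⟩, h.3, h.4⟩, fun h => ⟨h.1.1, h.1.2, h.2.1, h.2.2⟩⟩
  rw [this]
  refine MeasurableSet.inter (.inter (.iInter fun k => ?_) ?_) (.inter (.iInter fun k =>
    .iInter fun _ => ?_) ?_)
  · exact measurableSet_le measurable_const (measurable_pi_apply k)
  · exact measurableSet_eq_fun (by fun_prop) measurable_const
  · exact measurableSet_eq_fun (measurable_pi_apply k) measurable_const
  · exact measurableSet_lt measurable_const (measurable_pi_apply v)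

namespace IsBidWeight

variable {S : Set K} {v : K} {w : K → ℝ}

theorem le_one (h : IsBidWeight S v w) : w v ≤ 1 :=
  h.sum_eq ▸ Finset.single_le_sum (fun k _ => h.nonneg k) (Finset.mem_univ v)

theorem one_sub_le_odds (h : IsBidWeight S v w) : 1 - w v ≤ odds v w := by
  rw [odds, le_div_iff₀ h.pos]
  exact mul_le_of_le_one_right (sub_nonneg.2 h.le_one) h.le_one

theorem sum_exp_pos (h : IsBidWeight S v w) (η : ℝ) (μ : K → ℝ) :
    0 < ∑ l, w l * Real.exp (η * μ l) :=
  Finset.sum_pos' (fun l _ => mul_nonneg (h.nonneg l) (Real.exp_pos _).le)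
    ⟨v, Finset.mem_univ v, mul_pos h.pos (Real.exp_pos _)⟩

theorem expUpdate (h : IsBidWeight S v w) (η : ℝ) (μ : K → ℝ) :
    IsBidWeight S v (expUpdate η μ w) := by
  have hD := h.sum_exp_pos η μ
  refine ⟨fun k => ?_, ?_, fun k hk => ?_, ?_⟩
  · exact mul_nonneg (div_nonneg (Real.exp_pos _).le hD.le) (h.nonneg k)
  · simp only [CallAuction.expUpdate, div_mul_eq_mul_div]
    rw [← Finset.sum_div, div_eq_one_iff_eq hD.ne']
    exact Finset.sum_congr rfl fun k _ => mul_comm _ _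
  · simp [CallAuction.expUpdate, h.eq_zero k hk]
  · exact mul_pos (div_pos (Real.exp_pos _) hD) h.pos

/-- If every admissible bid other than `v` has exponential reward at most `κ` times that of `v`,
the update multiplies the odds against `v` by at most `κ`. -/
theorem odds_expUpdate_le (h : IsBidWeight S v w) {η κ : ℝ} {μ : K → ℝ}
    (hμ : ∀ k ∈ S, k ≠ v → Real.exp (η * μ k) ≤ κ * Real.exp (η * μ v)) :
    odds v (CallAuction.expUpdate η μ w) ≤ κ * odds v w := by
  classical
  have hD := h.sum_exp_pos η μ
  set D := ∑ l, w l * Real.exp (η * μ l) with hDdef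
  have he := Real.exp_pos (η * μ v)
  have key : D - Real.exp (η * μ v) * w v ≤ κ * Real.exp (η * μ v) * (1 - w v) := by
    have h1 : D - Real.exp (η * μ v) * w v
        = ∑ l ∈ Finset.univ.erase v, w l * Real.exp (η * μ l) := by
      rw [hDdef, ← Finset.add_sum_erase _ _ (Finset.mem_univ v)]; ring
    have h2 : 1 - w v = ∑ l ∈ Finset.univ.erase v, w l := by
      rw [← h.sum_eq, ← Finset.add_sum_erase _ _ (Finset.mem_univ v)]; ring
    rw [h1, h2, Finset.mul_sum]
    refine Finset.sum_le_sum fun l hl => ?_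
    by_cases hlS : l ∈ S
    · rw [mul_comm]
      exact mul_le_mul_of_nonneg_right (hμ l hlS (Finset.ne_of_mem_erase hl)) (h.nonneg l)
    · simp [h.eq_zero l hlS]
  have hv := h.pos
  have e1 : odds v (CallAuction.expUpdate η μ w)
      = (D - Real.exp (η * μ v) * w v) / (Real.exp (η * μ v) * w v) := by
    simp only [odds, CallAuction.expUpdate, ← hDdef]
    field_simp
  rw [e1, odds, div_le_iff₀ (by positivity)]
  calc _ ≤ _ := key
    _ = _ := by field_simp

end IsBidWeight

end ExpUpdate

/-! ### The Laplace law -/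

section Laplace

variable {σ L : ℝ}

theorem laplaceLaw_Ioi (hσ : 0 < σ) (hL : 0 ≤ L) :
    laplaceLaw σ (Set.Ioi L) = ENNReal.ofReal (1 / 2 * Real.exp (-L / σ)) := by
  have hσ' : -(1 / σ) < 0 := by simpa using hσ
  have hint := integrableOn_exp_mul_Ioi hσ' L
  rw [laplaceLaw, withDensity_apply _ measurableSet_Ioi, setLIntegral_congr_fun measurableSet_Ioi
    (g := fun x => ENNReal.ofReal (1 / (2 * σ) * Real.exp (-(1 / σ) * x))),
    ← ofReal_integral_eq_lintegral_ofReal (hint.const_mul _) (ae_of_all _ fun x => by positivity),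
    integral_const_mul, integral_exp_mul_Ioi hσ']
  · congr 1
    rw [show -(1 / σ) * L = -L / σ by ring]
    field_simp
  · intro x hx
    have : |x| = x := abs_of_nonneg (hL.trans (le_of_lt hx))
    simp only [this]
    congr 3
    ring

theorem laplaceLaw_Iic_neg (hσ : 0 < σ) (hL : 0 ≤ L) :
    laplaceLaw σ (Set.Iic (-L)) = ENNReal.ofReal (1 / 2 * Real.exp (-L / σ)) := by
  have hσ' : 0 < 1 / σ := by positivity
  have hint := integrableOn_exp_mul_Iic hσ' (-L)
  rw [laplaceLaw, withDensity_apply _ measurableSet_Iic, setLIntegral_congr_fun measurableSet_Iic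
    (g := fun x => ENNReal.ofReal (1 / (2 * σ) * Real.exp ((1 / σ) * x))),
    ← ofReal_integral_eq_lintegral_ofReal (hint.const_mul _) (ae_of_all _ fun x => by positivity),
    integral_const_mul, integral_exp_mul_Iic hσ']
  · congr 1
    rw [show 1 / σ * -L = -L / σ by ring]
    field_simp
  · intro x hx
    have : |x| = -x := abs_of_nonpos (le_trans hx (by linarith))
    simp only [this]
    congr 3
    ring

theorem isProbabilityMeasure_laplaceLaw (hσ : 0 < σ) : IsProbabilityMeasure (laplaceLaw σ) := by
  constructor
  have h := measure_union (μ := laplaceLaw σ) (Set.Iic_disjoint_Ioi (le_refl (-(0 : ℝ))))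
    measurableSet_Ioi
  rw [Set.Iic_union_Ioi, laplaceLaw_Iic_neg hσ le_rfl, neg_zero, laplaceLaw_Ioi hσ le_rfl,
    ← ENNReal.ofReal_add (by positivity) (by positivity)] at h
  rw [h]
  norm_num

theorem laplaceLaw_lt_abs_le (hσ : 0 < σ) (hL : 0 ≤ L) :
    laplaceLaw σ {x | L < |x|} ≤ ENNReal.ofReal (Real.exp (-L / σ)) := by
  have hsub : {x : ℝ | L < |x|} ⊆ Set.Iic (-L) ∪ Set.Ioi L := by
    intro x hx
    rcases lt_abs.1 (show L < |x| from hx) with h | h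
    · exact Or.inr h
    · exact Or.inl (by simp only [Set.mem_Iic]; linarith)
  refine (measure_mono hsub).trans ((measure_union_le _ _).trans ?_)
  rw [laplaceLaw_Iic_neg hσ hL, laplaceLaw_Ioi hσ hL,
    ← ENNReal.ofReal_add (by positivity) (by positivity)]
  exact ENNReal.ofReal_le_ofReal (by linarith)

theorem laplaceLaw_Iic_pos (hσ : 0 < σ) (a : ℝ) : 0 < laplaceLaw σ (Set.Iic a) := by
  refine lt_of_lt_of_le ?_ (measure_mono (Set.Iic_subset_Iic.2 (neg_abs_le a)))
  rw [laplaceLaw_Iic_neg hσ (abs_nonneg a)]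
  exact ENNReal.ofReal_pos.2 (by positivity)

theorem laplaceLaw_Ioi_zero_pos (hσ : 0 < σ) : 0 < laplaceLaw σ (Set.Ioi 0) := by
  rw [laplaceLaw_Ioi hσ le_rfl]
  exact ENNReal.ofReal_pos.2 (by positivity)

end Laplace

/-! ### The biases and the coins -/

section Coins

variable {c : ℝ}

theorem coinBias_nonneg (hc : 0 ≤ c) (x y : ℝ) : 0 ≤ coinBias c x y := by
  unfold coinBias
  split_ifs
  · exact hc
  · exact zero_le_one
  · positivity

theorem coinBias_le_one (hc : c ≤ 1) (x y : ℝ) : coinBias c x y ≤ 1 := by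
  unfold coinBias
  split_ifs
  · exact hc
  · exact le_rfl
  · exact min_le_left _ _

theorem coinBias_eq_one {x y : ℝ} (hx : 0 < x) (hy : y ≤ 0) : coinBias c x y = 1 := by
  simp [coinBias, max_eq_right hy, max_eq_left hx.le, hx.ne']

/-- The number of willing agents times the bias of their coins is at least the smaller of their
number and of the estimate of the other side. -/
theorem min_le_mul_coinBias (hc : 0 ≤ c) {s x y : ℝ} (hs : 0 ≤ s) (hy : y ≤ s) :
    min s x ≤ s * coinBias c x y := by
  unfold coinBias
  split_ifs with h1 h2
  · exact (min_le_right _ _).trans ((max_eq_right_iff.1 h2).trans (mul_nonneg hs hc))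
  · simp
  · have hy0 : 0 < max y 0 := lt_of_le_of_ne (le_max_right _ _) (Ne.symm h1)
    have hys : max y 0 ≤ s := max_le hy hs
    rcases le_total 1 (max x 0 / max y 0) with h | h
    · rw [min_eq_left h, mul_one]
      exact min_le_left _ _
    · rw [min_eq_right h]
      refine (min_le_right _ _).trans ((le_max_left x 0).trans ?_)
      rw [mul_div_assoc', le_div_iff₀ hy0, mul_comm]
      exact mul_le_mul_of_nonneg_right hys (le_max_right _ _)

theorem measurable_coinBias {X : Type*} [MeasurableSpace X] {f g : X → ℝ} (hf : Measurable f)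
    (hg : Measurable g) : Measurable fun x => coinBias c (f x) (g x) := by
  have hf' : Measurable fun x => max (f x) 0 := hf.max measurable_const
  have hg' : Measurable fun x => max (g x) 0 := hg.max measurable_const
  exact Measurable.ite (measurableSet_eq_fun hg' measurable_const)
    (Measurable.ite (measurableSet_eq_fun hf' measurable_const) measurable_const measurable_const)
    (measurable_const.min (hf'.div hg'))

theorem isProbabilityMeasure_bernoulliLaw {q : ℝ} (h0 : 0 ≤ q) (h1 : q ≤ 1) :
    IsProbabilityMeasure (bernoulliLaw q) := by
  refine isProbabilityMeasure_finiteLaw (fun x => ?_) (by simp)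
  split_ifs <;> linarith

instance (q : ℝ) : IsFiniteMeasure (bernoulliLaw q) :=
  inferInstanceAs (IsFiniteMeasure (finiteLaw _))

theorem isProbabilityMeasure_coinLaw (nS nB : ℕ) {qS qB : ℝ} (hS : 0 ≤ qS) (hS1 : qS ≤ 1)
    (hB : 0 ≤ qB) (hB1 : qB ≤ 1) : IsProbabilityMeasure (coinLaw nS nB qS qB) := by
  have := isProbabilityMeasure_bernoulliLaw hS hS1
  have := isProbabilityMeasure_bernoulliLaw hB hB1
  unfold coinLaw
  infer_instance

theorem measurable_coinLaw (nS nB : ℕ) :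
    Measurable fun q : ℝ × ℝ => coinLaw nS nB q.1 q.2 := by
  refine measurable_of_measurable_singleton fun ⟨a, b⟩ => ?_
  simp only [coinLaw, ← Set.singleton_prod_singleton, Measure.prod_prod, Measure.pi_singleton,
    bernoulliLaw, finiteLaw_singleton]
  refine Measurable.mul ?_ ?_ <;> refine Finset.measurable_prod _ fun i _ => ?_ <;>
    split_ifs <;> fun_prop

end Coins

/-! ### Measurability of the mechanism -/

section Mechanism

variable {V nS nB : ℕ} (θ : Params)

theorem measurable_supply :
    Measurable fun o : Round V nS nB => (supply o.1.1 o.2.1 : ℝ) := by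
  have h : Measurable fun a : ((Fin nS → Price V) × (Fin nB → Price V)) × Price V =>
      (supply a.1.1 a.2 : ℝ) := .of_discrete
  have h2 : Measurable fun o : Round V nS nB => (o.1, o.2.1) := by fun_prop
  have h3 := h.comp h2
  exact h3

theorem measurable_demand :
    Measurable fun o : Round V nS nB => (demand o.1.2 o.2.1 : ℝ) := by
  have h : Measurable fun a : ((Fin nS → Price V) × (Fin nB → Price V)) × Price V =>
      (demand a.1.2 a.2 : ℝ) := .of_discrete
  have h2 : Measurable fun o : Round V nS nB => (o.1, o.2.1) := by fun_prop
  have h3 := h.comp h2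
  exact h3

theorem measurable_round_sellerBias :
    Measurable fun o : Round V nS nB => sellerBias θ o.1.1 o.1.2 o.2.1 o.2.2.1 :=
  measurable_coinBias (measurable_demand.add (by fun_prop))
    ((measurable_supply.add (by fun_prop)).sub measurable_const)

theorem measurable_round_buyerBias :
    Measurable fun o : Round V nS nB => buyerBias θ o.1.1 o.1.2 o.2.1 o.2.2.1 :=
  measurable_coinBias (measurable_supply.add (by fun_prop))
    ((measurable_demand.add (by fun_prop)).sub measurable_const)

/-- The second half of the mechanism: coins flipped for given reports, price and noise. -/
def coinStage (r : (Fin nS → Price V) × (Fin nB → Price V)) (p : Price V) (z : ℝ × ℝ) :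
    Measure (Round V nS nB) :=
  (coinLaw nS nB (sellerBias θ r.1 r.2 p z) (buyerBias θ r.1 r.2 p z)).map fun x => (r, p, z, x)

/-- The last two stages of the mechanism: noise and coins for given reports and price. -/
def noiseStage (r : (Fin nS → Price V) × (Fin nB → Price V)) (p : Price V) :
    Measure (Round V nS nB) :=
  ((laplaceLaw (1 / θ.ε)).prod (laplaceLaw (1 / θ.ε))).bind (coinStage θ r p)

theorem mechanismLaw_eq (r : (Fin nS → Price V) × (Fin nB → Price V)) :
    mechanismLaw θ r = (priceLaw θ r.1 r.2).bind (noiseStage θ r) := rfl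

theorem measurable_coinStage (r : (Fin nS → Price V) × (Fin nB → Price V)) (p : Price V) :
    Measurable (coinStage θ r p) := by
  have hS : Measurable fun z => sellerBias θ r.1 r.2 p z :=
    measurable_coinBias (by fun_prop) (by fun_prop)
  have hB : Measurable fun z => buyerBias θ r.1 r.2 p z :=
    measurable_coinBias (by fun_prop) (by fun_prop)
  have hκ := (measurable_coinLaw nS nB).comp (hS.prodMk hB)
  have hf : Measurable (Function.uncurry fun (z : ℝ × ℝ) (x : (Fin nS → Bool) × (Fin nB → Bool)) =>
      ((r, p, z, x) : Round V nS nB)) := by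
    unfold Function.uncurry
    fun_prop
  have h := measurable_map_prodMk hκ hf
  exact h

variable {θ}

theorem isProbabilityMeasure_coinStage (hc : 0 ≤ θ.c) (hc1 : θ.c ≤ 1)
    (r : (Fin nS → Price V) × (Fin nB → Price V)) (p : Price V) (z : ℝ × ℝ) :
    IsProbabilityMeasure (coinStage θ r p z) := by
  have : IsProbabilityMeasure
      (coinLaw nS nB (sellerBias θ r.1 r.2 p z) (buyerBias θ r.1 r.2 p z)) :=
    isProbabilityMeasure_coinLaw nS nB (coinBias_nonneg hc _ _) (coinBias_le_one hc1 _ _)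
      (coinBias_nonneg hc _ _) (coinBias_le_one hc1 _ _)
  exact Measure.isProbabilityMeasure_map (by fun_prop)

theorem isProbabilityMeasure_noise (hε : 0 < θ.ε) :
    IsProbabilityMeasure ((laplaceLaw (1 / θ.ε)).prod (laplaceLaw (1 / θ.ε))) := by
  have := isProbabilityMeasure_laplaceLaw (one_div_pos.2 hε)
  infer_instance

theorem isProbabilityMeasure_noiseStage (hε : 0 < θ.ε) (hc : 0 ≤ θ.c) (hc1 : θ.c ≤ 1)
    (r : (Fin nS → Price V) × (Fin nB → Price V)) (p : Price V) :
    IsProbabilityMeasure (noiseStage θ r p) :=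
  have := isProbabilityMeasure_noise hε
  isProbabilityMeasure_bind (measurable_coinStage θ r p)
    (ae_of_all _ fun z => isProbabilityMeasure_coinStage hc hc1 r p z)

theorem sum_exp_clearable_pos [Nonempty (Price V)] (ε : ℝ) (rS : Fin nS → Price V)
    (rB : Fin nB → Price V) : 0 < ∑ p : Price V, Real.exp (ε * clearable p rS rB / 2) :=
  Finset.sum_pos (fun _ _ => Real.exp_pos _) Finset.univ_nonempty

theorem isProbabilityMeasure_priceLaw [Nonempty (Price V)] (rS : Fin nS → Price V)
    (rB : Fin nB → Price V) : IsProbabilityMeasure (priceLaw θ rS rB) := by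
  have hD := sum_exp_clearable_pos θ.ε rS rB
  refine isProbabilityMeasure_finiteLaw (fun p => div_nonneg (Real.exp_pos _).le hD.le) ?_
  rw [← Finset.sum_div, div_self hD.ne']

theorem isProbabilityMeasure_mechanismLaw [Nonempty (Price V)] (hε : 0 < θ.ε) (hc : 0 ≤ θ.c)
    (hc1 : θ.c ≤ 1) (r : (Fin nS → Price V) × (Fin nB → Price V)) :
    IsProbabilityMeasure (mechanismLaw θ r) :=
  have := isProbabilityMeasure_priceLaw (θ := θ) r.1 r.2
  isProbabilityMeasure_bind .of_discrete
    (ae_of_all _ fun p => isProbabilityMeasure_noiseStage hε hc hc1 r p)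

variable (θ)

theorem measurable_bidLaw : Measurable (bidLaw : Weights V nS nB → Measure _) := by
  refine measurable_of_measurable_singleton fun ⟨a, b⟩ => ?_
  simp only [bidLaw, ← Set.singleton_prod_singleton, Measure.prod_prod, Measure.pi_singleton,
    finiteLaw_singleton]
  fun_prop

theorem measurable_roundLaw : Measurable (roundLaw (V := V) (nS := nS) (nB := nB) θ) :=
  (Measure.measurable_bind' .of_discrete).comp measurable_bidLaw

theorem measurable_expUpdate {X K : Type*} [MeasurableSpace X] [Fintype K] (η : ℝ)
    {μ w : X → K → ℝ} (hμ : Measurable μ) (hw : Measurable w) :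
    Measurable fun x => expUpdate η (μ x) (w x) := by
  unfold expUpdate
  fun_prop

theorem measurable_sellerUtility (v : Price V) : Measurable fun o : Round V nS nB =>
    sellerUtility θ.ξ (sellerBias θ o.1.1 o.1.2 o.2.1 o.2.2.1) v o.2.1 := by
  have hq := measurable_round_sellerBias (V := V) (nS := nS) (nB := nB) θ
  have hp : Measurable fun o : Round V nS nB => o.2.1 := by fun_prop
  have h : ∀ g : Price V → ℝ, Measurable fun o : Round V nS nB => g o.2.1 :=
    fun g => (Measurable.of_discrete (f := g)).comp hp
  refine measurable_pi_lambda _ fun k => ?_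
  refine Measurable.ite (hp (.of_discrete (s := {p | v ≠ p}))) ?_ ?_
  · exact (hq.mul (h fun p => ((p : ℕ) : ℝ) - ((v : ℕ) : ℝ))).mul
      (h fun p => if k ≤ p then 1 else 0)
  · exact (hq.mul_const _).mul_const _

theorem measurable_buyerUtility (v : Price V) : Measurable fun o : Round V nS nB =>
    buyerUtility θ.ξ (buyerBias θ o.1.1 o.1.2 o.2.1 o.2.2.1) v o.2.1 := by
  have hq := measurable_round_buyerBias (V := V) (nS := nS) (nB := nB) θ
  have hp : Measurable fun o : Round V nS nB => o.2.1 := by fun_prop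
  have h : ∀ g : Price V → ℝ, Measurable fun o : Round V nS nB => g o.2.1 :=
    fun g => (Measurable.of_discrete (f := g)).comp hp
  refine measurable_pi_lambda _ fun k => ?_
  refine Measurable.ite (hp (.of_discrete (s := {p | v ≠ p}))) ?_ ?_
  · exact (hq.mul (h fun p => ((v : ℕ) : ℝ) - ((p : ℕ) : ℝ))).mul
      (h fun p => if p ≤ k then 1 else 0)
  · exact (hq.mul_const _).mul_const _

variable (vS : Fin nS → Price V) (vB : Fin nB → Price V)

theorem measurable_updateWeights :
    Measurable fun x : Weights V nS nB × Round V nS nB => updateWeights θ vS vB x.1 x.2 := by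
  refine Measurable.prodMk (measurable_pi_lambda _ fun i => ?_) (measurable_pi_lambda _ fun j => ?_)
  · exact measurable_expUpdate _ ((measurable_sellerUtility θ (vS i)).comp measurable_snd)
      (by fun_prop)
  · exact measurable_expUpdate _ ((measurable_buyerUtility θ (vB j)).comp measurable_snd)
      (by fun_prop)

theorem measurable_updateWeights_right (w : Weights V nS nB) :
    Measurable (updateWeights θ vS vB w) := by
  have h := (measurable_updateWeights θ vS vB).comp (measurable_prodMk_left (x := w))
  exact h

/-- The transition law of the weights depends measurably on the weights. -/
theorem measurable_weightsStep [Nonempty (Price V)] (hε : 0 < θ.ε) (hc : 0 ≤ θ.c)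
    (hc1 : θ.c ≤ 1) :
    Measurable fun w => (roundLaw θ w).map (updateWeights θ vS vB w) := by
  refine Measure.measurable_of_measurable_coe _ fun s hs => ?_
  have hu := measurable_updateWeights_right θ vS vB
  have h : ∀ w, (roundLaw θ w).map (updateWeights θ vS vB w) s =
      ∑ r, mechanismLaw θ r (updateWeights θ vS vB w ⁻¹' s) * bidLaw w {r} := by
    intro w
    rw [Measure.map_apply (hu w) hs, roundLaw,
      Measure.bind_apply (hu w hs) (Measurable.of_discrete).aemeasurable, lintegral_fintype]
  simp_rw [h]
  refine Finset.measurable_sum _ fun r _ => Measurable.mul ?_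
    ((Measure.measurable_coe (.singleton r)).comp measurable_bidLaw)
  have := isProbabilityMeasure_mechanismLaw hε hc hc1 r
  exact measurable_measure_prodMk_left (measurable_updateWeights θ vS vB hs)

end Mechanism

/-! ### Convergence of Social Exponential Weights to truthful bids -/

section Dynamics

variable {V nS nB : ℕ}

/-- At every price, the truthful bid of a seller is credited at least as much as a higher one. -/
theorem sellerUtility_le {ξ q : ℝ} (hξ : 0 ≤ ξ) (hq : 0 ≤ q) {v k : Price V} (hk : v ≤ k)
    (p : Price V) : sellerUtility ξ q v p k ≤ sellerUtility ξ q v p v := by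
  unfold sellerUtility
  by_cases hp : v = p
  · subst hp
    have : 0 ≤ q * ξ := mul_nonneg hq hξ
    by_cases hkv : k = v <;> simp [hkv, this]
  · by_cases hkp : k ≤ p
    · simp [hp, hkp, hk.trans hkp]
    · by_cases hvp : v ≤ p
      · have : (0 : ℝ) ≤ ((p : ℕ) : ℝ) - ((v : ℕ) : ℝ) := sub_nonneg.2 (by exact_mod_cast hvp)
        simpa [hp, hkp, hvp] using mul_nonneg hq this
      · simp [hp, hkp, hvp]

theorem buyerUtility_le {ξ q : ℝ} (hξ : 0 ≤ ξ) (hq : 0 ≤ q) {v k : Price V} (hk : k ≤ v)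
    (p : Price V) : buyerUtility ξ q v p k ≤ buyerUtility ξ q v p v := by
  unfold buyerUtility
  by_cases hp : v = p
  · subst hp
    have : 0 ≤ q * ξ := mul_nonneg hq hξ
    by_cases hkv : k = v <;> simp [hkv, this]
  · by_cases hkp : p ≤ k
    · simp [hp, hkp, hkp.trans hk]
    · by_cases hvp : p ≤ v
      · have : (0 : ℝ) ≤ ((v : ℕ) : ℝ) - ((p : ℕ) : ℝ) := sub_nonneg.2 (by exact_mod_cast hvp)
        simpa [hp, hkp, hvp] using mul_nonneg hq this
      · simp [hp, hkp, hvp]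

/-- All sellers bid at or above and all buyers at or below their valuations, and truthful bids
have positive weight. -/
def IsBidProfile (vS : Fin nS → Price V) (vB : Fin nB → Price V) (w : Weights V nS nB) : Prop :=
  (∀ i, IsBidWeight (Set.Ici (vS i)) (vS i) (w.1 i)) ∧
    ∀ j, IsBidWeight (Set.Iic (vB j)) (vB j) (w.2 j)

variable (vS : Fin nS → Price V) (vB : Fin nB → Price V)

theorem measurableSet_isBidProfile : MeasurableSet {w | IsBidProfile vS vB w} := by
  have h : {w | IsBidProfile vS vB w} =
      (⋂ i, {w | IsBidWeight (Set.Ici (vS i)) (vS i) (w.1 i)}) ∩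
        ⋂ j, {w | IsBidWeight (Set.Iic (vB j)) (vB j) (w.2 j)} := by
    ext w
    simp [IsBidProfile]
  rw [h]
  refine .inter (.iInter fun i => ?_) (.iInter fun j => ?_)
  · exact (measurable_pi_apply i).comp measurable_fst (measurableSet_isBidWeight _ _)
  · exact (measurable_pi_apply j).comp measurable_snd (measurableSet_isBidWeight _ _)

theorem isBidProfile_initWeights : IsBidProfile vS vB (initWeights vS vB) := by
  refine ⟨fun i => ?_, fun j => ?_⟩
  · obtain ⟨h1, h2⟩ := Finset.mem_Icc.1 (vS i).2
    have h2' : (((vS i : ℕ)) : ℝ) ≤ V := by exact_mod_cast h2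
    have hpos : (0 : ℝ) < (V : ℝ) - ((vS i : ℕ) : ℝ) + 1 := by linarith
    refine ⟨fun k => ?_, ?_, fun k hk => if_neg hk, ?_⟩
    · simp only [initWeights]
      split_ifs <;> positivity
    · have : ∀ k : Price V, (initWeights vS vB).1 i k = (fun k : ℕ =>
          if (vS i : ℕ) ≤ k then 1 / ((V : ℝ) - ((vS i : ℕ) : ℝ) + 1) else 0) k := fun k => rfl
      simp only [this]
      rw [Finset.sum_coe_sort (Finset.Icc 1 V) (fun k : ℕ =>
        if (vS i : ℕ) ≤ k then 1 / ((V : ℝ) - ((vS i : ℕ) : ℝ) + 1) else 0), ← Finset.sum_filter,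
        show (Finset.Icc 1 V).filter (fun k => (vS i : ℕ) ≤ k) = Finset.Icc (vS i : ℕ) V by
          ext k; simp only [Finset.mem_filter, Finset.mem_Icc]; omega]
      rw [Finset.sum_const, Nat.card_Icc, nsmul_eq_mul, Nat.cast_sub (by omega)]
      push_cast
      field_simp
      ring
    · simpa [initWeights] using hpos
  · obtain ⟨h1, h2⟩ := Finset.mem_Icc.1 (vB j).2
    have hpos : (0 : ℝ) < ((vB j : ℕ) : ℝ) := by exact_mod_cast h1
    refine ⟨fun k => ?_, ?_, fun k hk => if_neg hk, ?_⟩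
    · simp only [initWeights]
      split_ifs <;> positivity
    · have : ∀ k : Price V, (initWeights vS vB).2 j k = (fun k : ℕ =>
          if k ≤ (vB j : ℕ) then 1 / ((vB j : ℕ) : ℝ) else 0) k := fun k => rfl
      simp only [this]
      rw [Finset.sum_coe_sort (Finset.Icc 1 V) (fun k : ℕ =>
        if k ≤ (vB j : ℕ) then 1 / ((vB j : ℕ) : ℝ) else 0), ← Finset.sum_filter,
        show (Finset.Icc 1 V).filter (fun k => k ≤ (vB j : ℕ)) = Finset.Icc 1 (vB j : ℕ) by
          ext k; simp only [Finset.mem_filter, Finset.mem_Icc]; omega]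
      rw [Finset.sum_const, Nat.card_Icc, nsmul_eq_mul, Nat.add_sub_cancel]
      field_simp
    · simpa [initWeights] using hpos

variable {vS vB} {θ : Params} {w : Weights V nS nB}

theorem IsBidProfile.updateWeights (h : IsBidProfile vS vB w) (o : Round V nS nB) :
    IsBidProfile vS vB (updateWeights θ vS vB w o) :=
  ⟨fun i => (h.1 i).expUpdate _ _, fun j => (h.2 j).expUpdate _ _⟩

theorem IsBidProfile.isProbabilityMeasure_bidLaw (h : IsBidProfile vS vB w) :
    IsProbabilityMeasure (bidLaw w) := by
  have := fun i => isProbabilityMeasure_finiteLaw (h.1 i).nonneg (h.1 i).sum_eq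
  have := fun j => isProbabilityMeasure_finiteLaw (h.2 j).nonneg (h.2 j).sum_eq
  unfold bidLaw
  infer_instance

/-- The probability that some agent misreports is at most the sum of the odds against truthful
bids. -/
theorem IsBidProfile.bidLaw_ne_le (h : IsBidProfile vS vB w) :
    bidLaw w {(vS, vB)}ᶜ ≤ ∑ i, ENNReal.ofReal (odds (vS i) (w.1 i)) +
      ∑ j, ENNReal.ofReal (odds (vB j) (w.2 j)) := by
  have hS := fun i => isProbabilityMeasure_finiteLaw (h.1 i).nonneg (h.1 i).sum_eq
  have hB := fun j => isProbabilityMeasure_finiteLaw (h.2 j).nonneg (h.2 j).sum_eq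
  have hsub : ({(vS, vB)}ᶜ : Set ((Fin nS → Price V) × (Fin nB → Price V))) ⊆
      (⋃ i, Prod.fst ⁻¹' (Function.eval i ⁻¹' {vS i}ᶜ)) ∪
        ⋃ j, Prod.snd ⁻¹' (Function.eval j ⁻¹' {vB j}ᶜ) := by
    rintro ⟨a, b⟩ hab
    by_contra hcon
    simp only [Set.mem_union, Set.mem_iUnion, Set.mem_preimage, Function.eval,
      Set.mem_compl_iff, Set.mem_singleton_iff, not_or, not_exists, not_not] at hcon
    exact hab (Prod.ext (funext hcon.1) (funext hcon.2))
  refine (measure_mono hsub).trans ((measure_union_le _ _).trans (add_le_add ?_ ?_))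
  · refine (measure_iUnion_fintype_le _ _).trans (Finset.sum_le_sum fun i _ => ?_)
    have hm : MeasurableSet (({vS i}ᶜ : Set (Price V))) := .of_discrete
    have e1 := (measurePreserving_fst (μ := Measure.pi fun i => finiteLaw (w.1 i))
      (ν := Measure.pi fun j => finiteLaw (w.2 j))).measure_preimage
      ((measurable_pi_apply i) hm).nullMeasurableSet
    have e2 := (measurePreserving_eval (fun i => finiteLaw (w.1 i)) i).measure_preimage
      hm.nullMeasurableSet
    exact (e1.trans (e2.trans (finiteLaw_compl_singleton (h.1 i).nonneg (h.1 i).sum_eq _))).trans_le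
      (ENNReal.ofReal_le_ofReal (h.1 i).one_sub_le_odds)
  · refine (measure_iUnion_fintype_le _ _).trans (Finset.sum_le_sum fun i _ => ?_)
    have hm : MeasurableSet (({vB i}ᶜ : Set (Price V))) := .of_discrete
    have e1 := (measurePreserving_snd (μ := Measure.pi fun i => finiteLaw (w.1 i))
      (ν := Measure.pi fun j => finiteLaw (w.2 j))).measure_preimage
      ((measurable_pi_apply i) hm).nullMeasurableSet
    have e2 := (measurePreserving_eval (fun i => finiteLaw (w.2 i)) i).measure_preimage
      hm.nullMeasurableSet
    exact (e1.trans (e2.trans (finiteLaw_compl_singleton (h.2 i).nonneg (h.2 i).sum_eq _))).trans_le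
      (ENNReal.ofReal_le_ofReal (h.2 i).one_sub_le_odds)

section

variable [Nonempty (Price V)]

theorem IsBidProfile.isProbabilityMeasure_roundLaw (hε : 0 < θ.ε) (hc : 0 ≤ θ.c) (hc1 : θ.c ≤ 1)
    (h : IsBidProfile vS vB w) : IsProbabilityMeasure (roundLaw θ w) :=
  have := h.isProbabilityMeasure_bidLaw
  isProbabilityMeasure_bind .of_discrete
    (ae_of_all _ fun r => isProbabilityMeasure_mechanismLaw hε hc hc1 r)

theorem lintegral_weightsLaw_succ (hε : 0 < θ.ε) (hc : 0 ≤ θ.c) (hc1 : θ.c ≤ 1)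
    {φ : Weights V nS nB → ℝ≥0∞} (hφ : Measurable φ) (n : ℕ) :
    ∫⁻ w, φ w ∂weightsLaw θ vS vB (n + 1) =
      ∫⁻ w, ∫⁻ o, φ (updateWeights θ vS vB w o) ∂roundLaw θ w ∂weightsLaw θ vS vB n := by
  rw [weightsLaw, Measure.lintegral_bind
    (measurable_weightsStep θ vS vB hε hc hc1).aemeasurable hφ.aemeasurable]
  exact lintegral_congr fun w =>
    lintegral_map hφ (measurable_updateWeights_right θ vS vB w)

/-- The weights are almost surely an admissible bid profile. The laws of the weights and of the
rounds are probability measures for this reason, as arbitrary weights need not sum to one. -/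
theorem weightsLaw_spec (hε : 0 < θ.ε) (hc : 0 ≤ θ.c) (hc1 : θ.c ≤ 1)
    (vS : Fin nS → Price V) (vB : Fin nB → Price V) (n : ℕ) :
    IsProbabilityMeasure (weightsLaw θ vS vB n) ∧
      ∀ᵐ w ∂weightsLaw θ vS vB n, IsBidProfile vS vB w := by
  induction n with
  | zero =>
    refine ⟨inferInstanceAs (IsProbabilityMeasure (Measure.dirac _)), ?_⟩
    rw [weightsLaw, ae_dirac_iff (measurableSet_isBidProfile vS vB)]
    exact isBidProfile_initWeights vS vB
  | succ n ih =>
    obtain ⟨h1, h2⟩ := ih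
    refine ⟨isProbabilityMeasure_bind (measurable_weightsStep θ vS vB hε hc hc1) ?_, ?_⟩
    · filter_upwards [h2] with w hw
      have := hw.isProbabilityMeasure_roundLaw hε hc hc1
      exact Measure.isProbabilityMeasure_map (measurable_updateWeights_right θ vS vB w).aemeasurable
    · have hm := (measurableSet_isBidProfile vS vB).compl
      change weightsLaw θ vS vB (n + 1) {w | IsBidProfile vS vB w}ᶜ = 0
      rw [← lintegral_indicator_one hm,
        lintegral_weightsLaw_succ hε hc hc1 (measurable_one.indicator hm)]
      rw [lintegral_congr_ae (g := fun _ => 0), lintegral_zero]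
      filter_upwards [h2] with w hw
      refine (lintegral_congr fun o => ?_).trans lintegral_zero
      simp [hw.updateWeights o]

theorem exists_pos_le_of_finite {ι : Type*} [Finite ι] {f : ι → ℝ≥0∞} (hf : ∀ i, 0 < f i) :
    ∃ δ : ℝ, 0 < δ ∧ ∀ i, ENNReal.ofReal δ ≤ f i := by
  rcases isEmpty_or_nonempty ι with h | h
  · exact ⟨1, one_pos, fun i => h.elim i⟩
  · obtain ⟨i₀, hi₀⟩ := Finite.exists_min f
    have hne : min (f i₀) 1 ≠ ∞ := (lt_of_le_of_lt (min_le_right _ _) ENNReal.one_lt_top).ne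
    refine ⟨(min (f i₀) 1).toReal,
      ENNReal.toReal_pos (lt_min (hf i₀) zero_lt_one).ne' hne, fun i => ?_⟩
    rw [ENNReal.ofReal_toReal hne]
    exact (min_le_left _ _).trans (hi₀ i)

/-- A factor that is `κ` on an event of probability at least `δ` and `1` elsewhere has mean at most
`1 - (1 - κ) δ`. -/
theorem lintegral_ite_le {X : Type*} [MeasurableSpace X] {m : Measure X} [IsProbabilityMeasure m]
    {E : Set X} (hE : MeasurableSet E) {δ κ : ℝ} (hκ : 0 ≤ κ) (hκ1 : κ ≤ 1)
    (hδ : ENNReal.ofReal δ ≤ m E) [DecidablePred (· ∈ E)] :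
    ∫⁻ x, (if x ∈ E then ENNReal.ofReal κ else 1) ∂m ≤ ENNReal.ofReal (1 - (1 - κ) * δ) := by
  have h : ∀ x, (if x ∈ E then ENNReal.ofReal κ else 1) =
      E.indicator (fun _ => ENNReal.ofReal κ) x + Eᶜ.indicator (fun _ => 1) x := by
    intro x
    by_cases hx : x ∈ E <;> simp [hx]
  have hδ' : δ ≤ m.real E := by
    rw [← ofReal_measureReal] at hδ
    exact (ENNReal.ofReal_le_ofReal_iff measureReal_nonneg).1 hδ
  simp_rw [h]
  rw [lintegral_add_left (measurable_const.indicator hE), lintegral_indicator_const hE,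
    lintegral_indicator_const hE.compl, ← ofReal_measureReal, ← ofReal_measureReal,
    probReal_compl_eq_one_sub hE, one_mul, ← ENNReal.ofReal_mul hκ, ← ENNReal.ofReal_add
      (mul_nonneg hκ measureReal_nonneg) (sub_nonneg.2 measureReal_le_one)]
  exact ENNReal.ofReal_le_ofReal (by nlinarith)

/-- A quantity that never grows, and shrinks by a fixed factor in every round in which an event
`E` occurs that is possible whatever the bids, tends to zero in mean. -/
theorem tendsto_lintegral_weightsLaw (hε : 0 < θ.ε) (hc : 0 ≤ θ.c) (hc1 : θ.c ≤ 1)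
    {φ : Weights V nS nB → ℝ≥0∞} (hφ : Measurable φ) (hinit : φ (initWeights vS vB) ≠ ∞)
    {E : Set (Round V nS nB)} (hE : MeasurableSet E) (hpos : ∀ r, 0 < mechanismLaw θ r E)
    {κ : ℝ} (hκ : 0 ≤ κ) (hκ1 : κ < 1)
    (hone : ∀ w, IsBidProfile vS vB w → ∀ o, φ (updateWeights θ vS vB w o) ≤ φ w)
    (hkap : ∀ w, IsBidProfile vS vB w → ∀ o ∈ E,
      φ (updateWeights θ vS vB w o) ≤ ENNReal.ofReal κ * φ w) :
    Tendsto (fun n => ∫⁻ w, φ w ∂weightsLaw θ vS vB n) atTop (𝓝 0) := by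
  classical
  obtain ⟨δ, hδ, hδr⟩ := exists_pos_le_of_finite hpos
  set ρ := ENNReal.ofReal (1 - (1 - κ) * δ) with hρ
  have hstep : ∀ w, IsBidProfile vS vB w →
      ∫⁻ o, φ (updateWeights θ vS vB w o) ∂roundLaw θ w ≤ ρ * φ w := by
    intro w hw
    have := hw.isProbabilityMeasure_roundLaw hε hc hc1
    have := hw.isProbabilityMeasure_bidLaw
    have hEw : ENNReal.ofReal δ ≤ roundLaw θ w E := by
      rw [roundLaw, Measure.bind_apply hE (Measurable.of_discrete).aemeasurable]
      calc ENNReal.ofReal δ = ∫⁻ _, ENNReal.ofReal δ ∂bidLaw w := by simp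
        _ ≤ _ := lintegral_mono hδr
    calc ∫⁻ o, φ (updateWeights θ vS vB w o) ∂roundLaw θ w
        ≤ ∫⁻ o, (if o ∈ E then ENNReal.ofReal κ else 1) * φ w ∂roundLaw θ w := by
          refine lintegral_mono fun o => ?_
          by_cases ho : o ∈ E
          · simpa [ho] using hkap w hw o ho
          · simpa [ho] using hone w hw o
      _ = (∫⁻ o, (if o ∈ E then ENNReal.ofReal κ else 1) ∂roundLaw θ w) * φ w :=
          lintegral_mul_const _ (Measurable.ite hE measurable_const measurable_const)
      _ ≤ ρ * φ w := by gcongr; exact lintegral_ite_le hE hκ hκ1.le hEw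
  have hbound : ∀ n, ∫⁻ w, φ w ∂weightsLaw θ vS vB n ≤ ρ ^ n * φ (initWeights vS vB) := by
    intro n
    induction n with
    | zero => simp [weightsLaw, lintegral_dirac' _ hφ]
    | succ n ih =>
      rw [lintegral_weightsLaw_succ hε hc hc1 hφ]
      calc _ ≤ ∫⁻ w, ρ * φ w ∂weightsLaw θ vS vB n :=
            lintegral_mono_ae ((weightsLaw_spec hε hc hc1 vS vB n).2.mono hstep)
        _ = ρ * ∫⁻ w, φ w ∂weightsLaw θ vS vB n := lintegral_const_mul _ hφ
        _ ≤ ρ * (ρ ^ n * φ (initWeights vS vB)) := by gcongr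
        _ = _ := by rw [pow_succ']; ring
  have hρ1 : ρ < 1 := by
    rw [hρ, ENNReal.ofReal_lt_one]
    nlinarith
  refine tendsto_of_tendsto_of_tendsto_of_le_of_le tendsto_const_nhds ?_ (fun n => zero_le) hbound
  have := ENNReal.Tendsto.mul_const (ENNReal.tendsto_pow_atTop_nhds_zero_of_lt_one hρ1)
    (Or.inr hinit)
  rwa [zero_mul] at this

/-- Any price, together with a set of noise values of positive probability, occurs with positive
probability. -/
theorem mechanismLaw_pos (hc : 0 ≤ θ.c) (hc1 : θ.c ≤ 1)
    (r : (Fin nS → Price V) × (Fin nB → Price V)) (v : Price V) {S : Set (ℝ × ℝ)}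
    (hS : MeasurableSet S) (hS0 : 0 < ((laplaceLaw (1 / θ.ε)).prod (laplaceLaw (1 / θ.ε))) S)
    {A : Set (Round V nS nB)} (hA : MeasurableSet A) (h : ∀ z ∈ S, ∀ x, (r, v, z, x) ∈ A) :
    0 < mechanismLaw θ r A := by
  have h1 : 0 < noiseStage θ r v A := by
    rw [noiseStage, Measure.bind_apply hA (measurable_coinStage θ r v).aemeasurable]
    refine hS0.trans_le ?_
    rw [← lintegral_indicator_one hS]
    refine lintegral_mono fun z => ?_
    by_cases hz : z ∈ S
    · have := isProbabilityMeasure_coinStage hc hc1 r v z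
      have hAz : coinStage θ r v z A = coinStage θ r v z Set.univ := by
        rw [coinStage, Measure.map_apply (by fun_prop) hA,
          Measure.map_apply (by fun_prop) MeasurableSet.univ]
        congr 1
        ext x
        simp [h z hz x]
      simp [hz, hAz]
    · simp [hz]
  rw [mechanismLaw_eq, Measure.bind_apply hA (Measurable.of_discrete).aemeasurable, priceLaw,
    lintegral_finiteLaw]
  refine lt_of_lt_of_le ?_ (Finset.single_le_sum (fun _ _ => zero_le) (Finset.mem_univ v))
  exact ENNReal.mul_pos (ENNReal.ofReal_pos.2
    (div_pos (Real.exp_pos _) (sum_exp_clearable_pos _ _ _))).ne' h1.ne'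

theorem tendsto_lintegral_seller_odds (hε : 0 < θ.ε) (hη : 0 < θ.η) (hξ : 0 < θ.ξ)
    (hc : 0 ≤ θ.c) (hc1 : θ.c ≤ 1) (vS : Fin nS → Price V) (vB : Fin nB → Price V) (i : Fin nS) :
    Tendsto (fun n => ∫⁻ w, ENNReal.ofReal (odds (vS i) (w.1 i)) ∂weightsLaw θ vS vB n)
      atTop (𝓝 0) := by
  have hσ : 0 < 1 / θ.ε := one_div_pos.2 hε
  have hprob := isProbabilityMeasure_laplaceLaw hσ
  refine tendsto_lintegral_weightsLaw hε hc hc1 (κ := Real.exp (-(θ.η * θ.ξ)))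
    (E := {o | o.2.1 = vS i ∧ sellerBias θ o.1.1 o.1.2 o.2.1 o.2.2.1 = 1}) ?_
    ENNReal.ofReal_ne_top ?_ ?_ (Real.exp_pos _).le (by simpa using mul_pos hη hξ) ?_ ?_
  · unfold odds
    fun_prop
  · exact .inter (measurableSet_eq_fun (by fun_prop) measurable_const)
      (measurableSet_eq_fun (measurable_round_sellerBias θ) measurable_const)
  · intro r
    -- The bias is 1 as soon as the seller count is pushed below the confidence margin while the
    -- noise on the buyer count is positive.
    refine mechanismLaw_pos hc hc1 r (vS i)
      (S := Set.Iic (Real.log (1 / θ.α) / θ.ε - supply r.1 (vS i)) ×ˢ Set.Ioi 0)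
      (measurableSet_Iic.prod measurableSet_Ioi) ?_ ?_ ?_
    · rw [Measure.prod_prod]
      exact ENNReal.mul_pos (laplaceLaw_Iic_pos hσ _).ne' (laplaceLaw_Ioi_zero_pos hσ).ne'
    · exact .inter (measurableSet_eq_fun (by fun_prop) measurable_const)
        (measurableSet_eq_fun (measurable_round_sellerBias θ) measurable_const)
    · rintro ⟨z1, z2⟩ ⟨h1, h2⟩ x
      simp only [Set.mem_Iic, Set.mem_Ioi] at h1 h2
      exact ⟨rfl, coinBias_eq_one (add_pos_of_nonneg_of_pos (Nat.cast_nonneg _) h2)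
        (by simp only; linarith)⟩
  · intro w hw o
    refine ENNReal.ofReal_le_ofReal (((hw.1 i).odds_expUpdate_le (κ := 1) fun k hk _ => ?_).trans_eq
      (one_mul _))
    rw [one_mul]
    exact Real.exp_le_exp.2 (mul_le_mul_of_nonneg_left
      (sellerUtility_le hξ.le (coinBias_nonneg hc _ _) hk _) hη.le)
  · rintro w hw o ⟨hp, hq⟩
    rw [← ENNReal.ofReal_mul (Real.exp_pos _).le]
    refine ENNReal.ofReal_le_ofReal ((hw.1 i).odds_expUpdate_le fun k hk hne => ?_)
    rw [← Real.exp_add, hq, hp]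
    simp [sellerUtility, hne]

theorem tendsto_lintegral_buyer_odds (hε : 0 < θ.ε) (hη : 0 < θ.η) (hξ : 0 < θ.ξ)
    (hc : 0 ≤ θ.c) (hc1 : θ.c ≤ 1) (vS : Fin nS → Price V) (vB : Fin nB → Price V) (j : Fin nB) :
    Tendsto (fun n => ∫⁻ w, ENNReal.ofReal (odds (vB j) (w.2 j)) ∂weightsLaw θ vS vB n)
      atTop (𝓝 0) := by
  have hσ : 0 < 1 / θ.ε := one_div_pos.2 hε
  have hprob := isProbabilityMeasure_laplaceLaw hσ
  refine tendsto_lintegral_weightsLaw hε hc hc1 (κ := Real.exp (-(θ.η * θ.ξ)))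
    (E := {o | o.2.1 = vB j ∧ buyerBias θ o.1.1 o.1.2 o.2.1 o.2.2.1 = 1}) ?_
    ENNReal.ofReal_ne_top ?_ ?_ (Real.exp_pos _).le (by simpa using mul_pos hη hξ) ?_ ?_
  · unfold odds
    fun_prop
  · exact .inter (measurableSet_eq_fun (by fun_prop) measurable_const)
      (measurableSet_eq_fun (measurable_round_buyerBias θ) measurable_const)
  · intro r
    -- As for sellers, with the roles of the two noise terms exchanged.
    refine mechanismLaw_pos hc hc1 r (vB j)
      (S := Set.Ioi 0 ×ˢ Set.Iic (Real.log (1 / θ.α) / θ.ε - demand r.2 (vB j)))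
      (measurableSet_Ioi.prod measurableSet_Iic) ?_ ?_ ?_
    · rw [Measure.prod_prod]
      exact ENNReal.mul_pos (laplaceLaw_Ioi_zero_pos hσ).ne' (laplaceLaw_Iic_pos hσ _).ne'
    · exact .inter (measurableSet_eq_fun (by fun_prop) measurable_const)
        (measurableSet_eq_fun (measurable_round_buyerBias θ) measurable_const)
    · rintro ⟨z1, z2⟩ ⟨h1, h2⟩ x
      simp only [Set.mem_Iic, Set.mem_Ioi] at h1 h2
      exact ⟨rfl, coinBias_eq_one (add_pos_of_nonneg_of_pos (Nat.cast_nonneg _) h1)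
        (by simp only; linarith)⟩
  · intro w hw o
    refine ENNReal.ofReal_le_ofReal (((hw.2 j).odds_expUpdate_le (κ := 1) fun k hk _ => ?_).trans_eq
      (one_mul _))
    rw [one_mul]
    exact Real.exp_le_exp.2 (mul_le_mul_of_nonneg_left
      (buyerUtility_le hξ.le (coinBias_nonneg hc _ _) hk _) hη.le)
  · rintro w hw o ⟨hp, hq⟩
    rw [← ENNReal.ofReal_mul (Real.exp_pos _).le]
    refine ENNReal.ofReal_le_ofReal ((hw.2 j).odds_expUpdate_le fun k hk hne => ?_)
    rw [← Real.exp_add, hq, hp]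
    simp [buyerUtility, hne]

end

end Dynamics

/-! ### Tail bounds for one run of the mechanism -/

section Tails

theorem exp_neg_le_quadratic {x : ℝ} (hx : 0 ≤ x) : Real.exp (-x) ≤ 1 - x + x ^ 2 / 2 := by
  have h := Real.quadratic_le_exp_of_nonneg hx
  have hpos : 0 < 1 - x + x ^ 2 / 2 := by nlinarith [sq_nonneg (x - 1)]
  rw [Real.exp_neg, inv_le_comm₀ (Real.exp_pos _) hpos, inv_le_iff_one_le_mul₀ hpos]
  calc (1 : ℝ) ≤ (1 + x + x ^ 2 / 2) * (1 - x + x ^ 2 / 2) := by nlinarith [sq_nonneg (x ^ 2)]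
    _ ≤ _ := by gcongr

theorem integral_bernoulliLaw {q : ℝ} (h0 : 0 ≤ q) (h1 : q ≤ 1) (f : Bool → ℝ) :
    ∫ x, f x ∂bernoulliLaw q = q * f true + (1 - q) * f false := by
  have : ∀ x, (bernoulliLaw q).real {x} = if x = true then q else 1 - q := by
    intro x
    rw [measureReal_def, bernoulliLaw, finiteLaw_singleton, ENNReal.toReal_ofReal]
    split_ifs <;> linarith
  rw [integral_fintype Integrable.of_finite]
  simp [this]

/-- Chernoff's lower tail bound: among independent coins of bias `q`, those in `T` succeed in
expectation at least `m` times, and fall below `B` with probability at most `exp (-l)` if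
`2 m l ≤ (m - B) ^ 2`. -/
theorem chernoff_lower {n : ℕ} {q : ℝ} (h0 : 0 ≤ q) (h1 : q ≤ 1) (T : Finset (Fin n))
    {m B l : ℝ} (hm : m ≤ T.card * q) (hB : B ≤ m) (hl : 2 * m * l ≤ (m - B) ^ 2) :
    (Measure.pi fun _ : Fin n => bernoulliLaw q)
      {x | ((T.filter fun i => x i = true).card : ℝ) < B} ≤ ENNReal.ofReal (Real.exp (-l)) := by
  have := isProbabilityMeasure_bernoulliLaw h0 h1
  set μ := Measure.pi fun _ : Fin n => bernoulliLaw q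
  -- A threshold that is not positive is never missed.
  rcases le_or_gt B 0 with hB0 | hB0
  · have : {x : Fin n → Bool | ((T.filter fun i => x i = true).card : ℝ) < B} = ∅ := by
      ext x
      simpa using hB0.trans (Nat.cast_nonneg _)
    simp [this]
  have hm0 : 0 < m := hB0.trans_le hB
  -- The choice of `t` minimizes the exponent `t * B - m * (t - t ^ 2 / 2)`.
  set t := (m - B) / m with ht
  have ht0 : 0 ≤ t := div_nonneg (sub_nonneg.2 hB) hm0.le
  have ht1 : t ≤ 1 := (div_le_one hm0).2 (by linarith)
  let f : Fin n → Bool → ℝ := fun i x => if i ∈ T ∧ x = true then Real.exp (-t) else 1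
  have hprod : ∀ x : Fin n → Bool,
      ∏ i, f i (x i) = Real.exp (-t * (T.filter fun i => x i = true).card) := by
    intro x
    have h : T.filter (fun i => x i = true) = Finset.univ.filter fun i => i ∈ T ∧ x i = true := by
      ext i; simp
    rw [Finset.prod_ite, Finset.prod_const, Finset.prod_const_one, mul_one, h, ← Real.exp_nat_mul,
      mul_comm]
  have hint : ∫ x, ∏ i, f i (x i) ∂μ ≤ Real.exp (-(m * (t - t ^ 2 / 2))) := by
    rw [integral_fintype_prod_eq_prod]
    have hi : ∀ i, ∫ x, f i x ∂bernoulliLaw q = if i ∈ T then q * Real.exp (-t) + (1 - q) else 1 := by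
      intro i
      rw [integral_bernoulliLaw h0 h1]
      by_cases hi : i ∈ T <;> simp [f, hi]
    simp_rw [hi]
    rw [Finset.prod_ite, Finset.prod_const, Finset.prod_const_one, mul_one,
      Finset.filter_univ_mem]
    calc (q * Real.exp (-t) + (1 - q)) ^ T.card
        ≤ Real.exp (-(q * (t - t ^ 2 / 2))) ^ T.card := by
          have e1 := Real.add_one_le_exp (-(q * (t - t ^ 2 / 2)))
          have e2 := mul_le_mul_of_nonneg_left (exp_neg_le_quadratic ht0) h0
          refine pow_le_pow_left₀ ?_ (by linarith) _
          have := mul_nonneg h0 (Real.exp_pos (-t)).le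
          linarith
      _ = Real.exp (-((T.card * q) * (t - t ^ 2 / 2))) := by
          rw [← Real.exp_nat_mul]; ring_nf
      _ ≤ _ := by
          refine Real.exp_le_exp.2 (neg_le_neg (mul_le_mul_of_nonneg_right hm ?_))
          nlinarith
  have hmarkov := mul_meas_ge_le_integral_of_nonneg (μ := μ) (f := fun x => ∏ i, f i (x i))
    (ae_of_all _ fun x => by simp only [hprod]; positivity) Integrable.of_finite
    (Real.exp (-t * B))
  have hsub : {x : Fin n → Bool | ((T.filter fun i => x i = true).card : ℝ) < B} ⊆
      {x | Real.exp (-t * B) ≤ ∏ i, f i (x i)} := by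
    intro x hx
    have hx' : ((T.filter fun i => x i = true).card : ℝ) < B := hx
    change Real.exp (-t * B) ≤ ∏ i, f i (x i)
    rw [hprod]
    exact Real.exp_le_exp.2 (by nlinarith)
  rw [← ofReal_measureReal]
  refine ENNReal.ofReal_le_ofReal ((measureReal_mono hsub).trans ?_)
  have h2 := hmarkov.trans hint
  rw [mul_comm, ← le_div_iff₀ (Real.exp_pos _), ← Real.exp_sub] at h2
  refine h2.trans (Real.exp_le_exp.2 ?_)
  have e : -(m * (t - t ^ 2 / 2)) - -t * B = -((m - B) ^ 2 / (2 * m)) := by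
    rw [ht]; field_simp; ring
  rw [e]
  refine neg_le_neg ((le_div_iff₀ (by positivity)).2 (by linarith))

variable {V nS nB : ℕ} {θ : Params}

theorem Round.payoff_eq (o : Round V nS nB) :
    o.payoff = min (Finset.univ.filter fun i => o.1.1 i ≤ o.2.1 ∧ o.2.2.2.1 i = true).card
      (Finset.univ.filter fun j => o.2.1 ≤ o.1.2 j ∧ o.2.2.2.2 j = true).card := by
  classical
  unfold Round.payoff
  refine congrArg₂ min ?_ ?_ <;> refine congrArg Finset.card (Finset.ext fun _ => ?_) <;>
    rw [Finset.mem_filter, Finset.mem_filter] <;> rfl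

theorem Round.payoff_le_clearable (o : Round V nS nB) : o.payoff ≤ o.clearable := by
  classical
  refine min_le_min (Finset.card_le_card fun i hi => ?_) (Finset.card_le_card fun j hj => ?_)
  · simp only [Finset.mem_filter] at hi ⊢
    exact ⟨hi.1, hi.2.1⟩
  · simp only [Finset.mem_filter] at hj ⊢
    exact ⟨hj.1, hj.2.1⟩

theorem measurable_payoff : Measurable (Round.payoff : Round V nS nB → ℕ) := by
  have h : Measurable fun a : (((Fin nS → Price V) × (Fin nB → Price V)) × Price V) ×
      ((Fin nS → Bool) × (Fin nB → Bool)) => Round.payoff (a.1.1, a.1.2, (0, 0), a.2) :=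
    .of_discrete
  have h2 : Measurable fun o : Round V nS nB => ((o.1, o.2.1), o.2.2.2) := by fun_prop
  have h3 := h.comp h2
  exact h3

/-- Utility guarantee of the exponential mechanism. -/
theorem priceLaw_lt_le (hV : 1 ≤ V) (hε : 0 < θ.ε) {α : ℝ} (hα : 0 < α) (rS : Fin nS → Price V)
    (rB : Fin nB → Price V) :
    priceLaw θ rS rB {p | (clearable p rS rB : ℝ) < opt rS rB - 2 * Real.log (V / α) / θ.ε} ≤
      ENNReal.ofReal α := by
  classical
  have hne : Nonempty (Price V) := ⟨⟨1, Finset.mem_Icc.2 ⟨le_rfl, hV⟩⟩⟩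
  have hD := sum_exp_clearable_pos θ.ε rS rB
  have hV0 : (0 : ℝ) < V := by exact_mod_cast hV
  obtain ⟨p₀, -, hp₀⟩ := Finset.exists_mem_eq_sup Finset.univ Finset.univ_nonempty
    fun p => clearable p rS rB
  have hopt : Real.exp (θ.ε * opt rS rB / 2) ≤
      ∑ p : Price V, Real.exp (θ.ε * clearable p rS rB / 2) := by
    rw [opt, hp₀]
    exact Finset.single_le_sum (f := fun p => Real.exp (θ.ε * clearable p rS rB / 2))
      (fun _ _ => (Real.exp_pos _).le) (Finset.mem_univ p₀)
  rw [priceLaw, finiteLaw_apply]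
  calc _ ≤ ∑ _p : Price V, ENNReal.ofReal (α / V) := by
        refine Finset.sum_le_sum fun p _ => ?_
        by_cases hp : (clearable p rS rB : ℝ) < opt rS rB - 2 * Real.log (V / α) / θ.ε
        · rw [Set.indicator_of_mem (by exact hp), Pi.one_apply, mul_one]
          refine ENNReal.ofReal_le_ofReal ((div_le_iff₀ hD).2 ?_)
          have h1 : θ.ε * clearable p rS rB / 2 ≤
              Real.log (α / V) + θ.ε * opt rS rB / 2 := by
            have h2 := mul_lt_mul_of_pos_left hp hε
            have h3 : θ.ε * (opt rS rB - 2 * Real.log (V / α) / θ.ε) =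
                θ.ε * opt rS rB - 2 * Real.log (V / α) := by field_simp
            have h4 : Real.log (α / V) = -Real.log (V / α) := by
              rw [← Real.log_inv, inv_div]
            rw [h3] at h2
            linarith
          calc _ ≤ _ := Real.exp_le_exp.2 h1
            _ = α / V * Real.exp (θ.ε * opt rS rB / 2) := by
              rw [Real.exp_add, Real.exp_log (by positivity)]
            _ ≤ _ := by gcongr
        · rw [Set.indicator_of_notMem (by exact hp), mul_zero]
          exact zero_le
    _ = ENNReal.ofReal α := by
        rw [Finset.sum_const, Finset.card_univ, Fintype.card_coe, Nat.card_Icc, nsmul_eq_mul,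
          Nat.add_sub_cancel, ← ENNReal.ofReal_natCast, ← ENNReal.ofReal_mul hV0.le]
        congr 1
        field_simp

theorem noise_abs_gt_le (hε : 0 < θ.ε) {α : ℝ} (hα : 0 < α) (hα1 : α < 1) :
    ((laplaceLaw (1 / θ.ε)).prod (laplaceLaw (1 / θ.ε)))
      {z | |z.1| ≤ Real.log (1 / α) / θ.ε ∧ |z.2| ≤ Real.log (1 / α) / θ.ε}ᶜ ≤
      2 * ENNReal.ofReal α := by
  have hσ : 0 < 1 / θ.ε := one_div_pos.2 hε
  have hprob := isProbabilityMeasure_laplaceLaw hσ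
  set L := Real.log (1 / α) / θ.ε with hL
  have hL0 : 0 ≤ L := div_nonneg (Real.log_nonneg ((one_le_div hα).2 hα1.le)) hε.le
  have hexp : Real.exp (-L / (1 / θ.ε)) = α := by
    rw [hL, show -(Real.log (1 / α) / θ.ε) / (1 / θ.ε) = -Real.log (1 / α) by field_simp,
      ← Real.log_inv, one_div, inv_inv, Real.exp_log hα]
  have hsub : {z : ℝ × ℝ | |z.1| ≤ L ∧ |z.2| ≤ L}ᶜ ⊆
      (Prod.fst ⁻¹' {x | L < |x|}) ∪ (Prod.snd ⁻¹' {x | L < |x|}) := by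
    intro z hz
    by_contra hcon
    simp only [Set.mem_union, not_or, Set.mem_preimage, Set.mem_ofPred_eq, not_lt] at hcon
    exact hz hcon
  have hm : MeasurableSet {x : ℝ | L < |x|} := measurableSet_lt measurable_const (by fun_prop)
  refine (measure_mono hsub).trans ((measure_union_le _ _).trans ?_)
  rw [(measurePreserving_fst (μ := laplaceLaw (1 / θ.ε))
      (ν := laplaceLaw (1 / θ.ε))).measure_preimage hm.nullMeasurableSet,
    (measurePreserving_snd (μ := laplaceLaw (1 / θ.ε))
      (ν := laplaceLaw (1 / θ.ε))).measure_preimage hm.nullMeasurableSet, two_mul]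
  have := laplaceLaw_lt_abs_le hσ hL0
  rw [hexp] at this
  exact add_le_add this this

/-- With noise within the confidence margin `L`, the coins clear with high probability all but `L`
and a square root term of the shares that the price can clear. -/
theorem coinStage_payoff_lt_le (hc : 0 ≤ θ.c) (hc1 : θ.c ≤ 1)
    (r : (Fin nS → Price V) × (Fin nB → Price V)) (p : Price V) {z : ℝ × ℝ} {B m l : ℝ}
    (hz1 : |z.1| ≤ Real.log (1 / θ.α) / θ.ε) (hz2 : |z.2| ≤ Real.log (1 / θ.α) / θ.ε)
    (hm : m ≤ clearable p r.1 r.2 - Real.log (1 / θ.α) / θ.ε) (hB : B ≤ m)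
    (hl : 2 * m * l ≤ (m - B) ^ 2) :
    coinStage θ r p z {o | (o.payoff : ℝ) < B} ≤ 2 * ENNReal.ofReal (Real.exp (-l)) := by
  classical
  have hqS0 : 0 ≤ sellerBias θ r.1 r.2 p z := coinBias_nonneg hc _ _
  have hqS1 : sellerBias θ r.1 r.2 p z ≤ 1 := coinBias_le_one hc1 _ _
  have hqB0 : 0 ≤ buyerBias θ r.1 r.2 p z := coinBias_nonneg hc _ _
  have hqB1 : buyerBias θ r.1 r.2 p z ≤ 1 := coinBias_le_one hc1 _ _
  obtain ⟨hz1a, hz1b⟩ := abs_le.1 hz1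
  obtain ⟨hz2a, hz2b⟩ := abs_le.1 hz2
  set L := Real.log (1 / θ.α) / θ.ε with hL
  have hcs : (clearable p r.1 r.2 : ℝ) ≤ supply r.1 p := by
    exact_mod_cast min_le_left _ _
  have hcd : (clearable p r.1 r.2 : ℝ) ≤ demand r.2 p := by
    exact_mod_cast min_le_right _ _
  have hL0 : 0 ≤ L := (abs_nonneg _).trans hz1
  have hmS : m ≤ supply r.1 p * sellerBias θ r.1 r.2 p z :=
    (le_min (by linarith) (by linarith)).trans
      (min_le_mul_coinBias hc (Nat.cast_nonneg _) (by linarith))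
  have hmB : m ≤ demand r.2 p * buyerBias θ r.1 r.2 p z :=
    (le_min (by linarith) (by linarith)).trans
      (min_le_mul_coinBias hc (Nat.cast_nonneg _) (by linarith))
  have hS := chernoff_lower hqS0 hqS1 (Finset.univ.filter fun i => r.1 i ≤ p) hmS hB hl
  have hD := chernoff_lower hqB0 hqB1 (Finset.univ.filter fun j => p ≤ r.2 j) hmB hB hl
  have := isProbabilityMeasure_bernoulliLaw hqS0 hqS1
  have := isProbabilityMeasure_bernoulliLaw hqB0 hqB1
  have hmeas : MeasurableSet {o : Round V nS nB | (o.payoff : ℝ) < B} :=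
    measurable_payoff (.of_discrete (s := {k : ℕ | (k : ℝ) < B}))
  rw [coinStage, Measure.map_apply (by fun_prop) hmeas, coinLaw]
  -- The payoff is small only if one of the two sides has few successful coins.
  have hsub : (fun x => ((r, p, z, x) : Round V nS nB)) ⁻¹'
      {o : Round V nS nB | (o.payoff : ℝ) < B} ⊆
      (Prod.fst ⁻¹' {x | (((Finset.univ.filter fun i => r.1 i ≤ p).filter
          fun i => x i = true).card : ℝ) < B}) ∪
        (Prod.snd ⁻¹' {x | (((Finset.univ.filter fun j => p ≤ r.2 j).filter
          fun j => x j = true).card : ℝ) < B}) := by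
    intro x hx
    have hx' : (Round.payoff ((r, p, z, x) : Round V nS nB) : ℝ) < B := hx
    rw [Round.payoff_eq, Nat.cast_min, min_lt_iff] at hx'
    simpa only [Set.mem_union, Set.mem_preimage, Set.mem_ofPred_eq, Finset.filter_filter] using hx'
  refine (measure_mono hsub).trans ((measure_union_le _ _).trans ?_)
  rw [measurePreserving_fst.measure_preimage (MeasurableSet.of_discrete).nullMeasurableSet,
    measurePreserving_snd.measure_preimage (MeasurableSet.of_discrete).nullMeasurableSet, two_mul]
  exact add_le_add hS hD

/-- On any fixed reports, the shares cleared by one run of the mechanism fall short of the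
optimum for these reports by more than the stated error with probability at most `5 α`. -/
theorem mechanismLaw_payoff_lt_le (hV : 1 ≤ V) (hε : 0 < θ.ε) (hα : 0 < θ.α) (hα1 : θ.α < 1)
    (hc : 0 ≤ θ.c) (hc1 : θ.c ≤ 1) (r : (Fin nS → Price V) × (Fin nB → Price V)) :
    mechanismLaw θ r {o | (o.payoff : ℝ) < opt r.1 r.2 - 2 * Real.log (V / θ.α) / θ.ε
        - 2 * Real.log (1 / θ.α) / θ.ε
        - √(6 * (opt r.1 r.2 + Real.log (1 / θ.α) / θ.ε) * Real.log (1 / θ.α))} ≤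
      ENNReal.ofReal (5 * θ.α) := by
  have hne : Nonempty (Price V) := ⟨⟨1, Finset.mem_Icc.2 ⟨le_rfl, hV⟩⟩⟩
  have hl0 : 0 ≤ Real.log (1 / θ.α) := Real.log_nonneg ((one_le_div hα).2 hα1.le)
  have hL0 : 0 ≤ Real.log (1 / θ.α) / θ.ε := div_nonneg hl0 hε.le
  have hA0 : 0 ≤ 2 * Real.log (V / θ.α) / θ.ε := by
    have hV1 : (1 : ℝ) ≤ V := by exact_mod_cast hV
    have : 0 ≤ Real.log (V / θ.α) := Real.log_nonneg ((one_le_div hα).2 (by linarith))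
    positivity
  have hexp : Real.exp (-Real.log (1 / θ.α)) = θ.α := by
    rw [← Real.log_inv, one_div, inv_inv, Real.exp_log hα]
  rw [mul_div_assoc 2 (Real.log (1 / θ.α))]
  have hO : (0 : ℝ) ≤ opt r.1 r.2 := Nat.cast_nonneg _
  set B : ℝ := opt r.1 r.2 - 2 * Real.log (V / θ.α) / θ.ε - 2 * (Real.log (1 / θ.α) / θ.ε)
    - √(6 * (opt r.1 r.2 + Real.log (1 / θ.α) / θ.ε) * Real.log (1 / θ.α)) with hB
  have hmeas : MeasurableSet {o : Round V nS nB | (o.payoff : ℝ) < B} :=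
    measurable_payoff (.of_discrete (s := {k : ℕ | (k : ℝ) < B}))
  have hprice := isProbabilityMeasure_priceLaw (θ := θ) r.1 r.2
  have hnoise := isProbabilityMeasure_noise hε
  have h5 : ENNReal.ofReal (5 * θ.α) =
      ENNReal.ofReal θ.α + (2 * ENNReal.ofReal θ.α + 2 * ENNReal.ofReal θ.α) := by
    rw [ENNReal.ofReal_mul (by norm_num), ENNReal.ofReal_ofNat]
    ring
  rw [h5, mechanismLaw_eq]
  refine bind_apply_le_add .of_discrete
    (fun p => (isProbabilityMeasure_noiseStage hε hc hc1 r p).measure_univ.le)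
    (G := {p | (clearable p r.1 r.2 : ℝ) < opt r.1 r.2 - 2 * Real.log (V / θ.α) / θ.ε}ᶜ)
    .of_discrete (by rw [compl_compl]; exact priceLaw_lt_le hV hε hα r.1 r.2) hmeas
    fun p hp => ?_
  have hp' : (opt r.1 r.2 : ℝ) - 2 * Real.log (V / θ.α) / θ.ε ≤ clearable p r.1 r.2 := not_lt.1 hp
  have hmeasz : MeasurableSet {z : ℝ × ℝ |
      |z.1| ≤ Real.log (1 / θ.α) / θ.ε ∧ |z.2| ≤ Real.log (1 / θ.α) / θ.ε} :=
    .inter (measurableSet_le (f := fun z : ℝ × ℝ => |z.1|) (by fun_prop) measurable_const)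
      (measurableSet_le (f := fun z : ℝ × ℝ => |z.2|) (by fun_prop) measurable_const)
  refine bind_apply_le_add (measurable_coinStage θ r p)
    (fun z => (isProbabilityMeasure_coinStage hc hc1 r p z).measure_univ.le)
    (G := {z | |z.1| ≤ Real.log (1 / θ.α) / θ.ε ∧ |z.2| ≤ Real.log (1 / θ.α) / θ.ε})
    hmeasz
    (noise_abs_gt_le hε hα hα1) hmeas fun z hz => ?_
  have hsq0 : 0 ≤ 6 * (opt r.1 r.2 + Real.log (1 / θ.α) / θ.ε) * Real.log (1 / θ.α) := by positivity
  have hs := Real.sq_sqrt hsq0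
  have hs0 := Real.sqrt_nonneg (6 * (opt r.1 r.2 + Real.log (1 / θ.α) / θ.ε) * Real.log (1 / θ.α))
  have h := coinStage_payoff_lt_le hc hc1 r p (B := B)
    (m := opt r.1 r.2 - 2 * Real.log (V / θ.α) / θ.ε - Real.log (1 / θ.α) / θ.ε)
    (l := Real.log (1 / θ.α)) hz.1 hz.2 (by linarith) (by rw [hB]; linarith) ?_
  · rwa [hexp] at h
  · set s := √(6 * (opt r.1 r.2 + Real.log (1 / θ.α) / θ.ε) * Real.log (1 / θ.α))
    set L := Real.log (1 / θ.α) / θ.ε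
    set A := 2 * Real.log (V / θ.α) / θ.ε
    set l := Real.log (1 / θ.α)
    set O : ℝ := (opt r.1 r.2 : ℝ)
    calc 2 * (O - A - L) * l ≤ 6 * (O + L) * l := by
          refine mul_le_mul_of_nonneg_right ?_ hl0
          linarith
      _ = s ^ 2 := hs.symm
      _ ≤ (L + s) ^ 2 := pow_le_pow_left₀ hs0 (by linarith) 2
      _ = _ := by rw [hB]; ring

end Tails

/-! ### The repeated auction -/

section Repeated

variable {V nS nB : ℕ} {θ : Params}

/-- In round `t` the payoff falls short of the bound because somebody misreports, or because the
mechanism fails on truthful reports. -/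
theorem repeatedLaw_payoff_lt_le (hV : 1 ≤ V) (hε : 0 < θ.ε) (hα : 0 < θ.α) (hα1 : θ.α < 1)
    (hc : 0 ≤ θ.c) (hc1 : θ.c ≤ 1) (vS : Fin nS → Price V) (vB : Fin nB → Price V) (t : ℕ) :
    repeatedLaw θ vS vB t {o | (o.payoff : ℝ) < opt vS vB - 2 * Real.log (V / θ.α) / θ.ε
        - 2 * Real.log (1 / θ.α) / θ.ε
        - √(6 * (opt vS vB + Real.log (1 / θ.α) / θ.ε) * Real.log (1 / θ.α))} ≤
      (∑ i, ∫⁻ w, ENNReal.ofReal (odds (vS i) (w.1 i)) ∂weightsLaw θ vS vB (t - 1) +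
        ∑ j, ∫⁻ w, ENNReal.ofReal (odds (vB j) (w.2 j)) ∂weightsLaw θ vS vB (t - 1)) +
      ENNReal.ofReal (5 * θ.α) := by
  have hne : Nonempty (Price V) := ⟨⟨1, Finset.mem_Icc.2 ⟨le_rfl, hV⟩⟩⟩
  have hmech := mechanismLaw_payoff_lt_le hV hε hα hα1 hc hc1 (vS, vB)
  set B : ℝ := opt vS vB - 2 * Real.log (V / θ.α) / θ.ε - 2 * Real.log (1 / θ.α) / θ.ε
    - √(6 * (opt vS vB + Real.log (1 / θ.α) / θ.ε) * Real.log (1 / θ.α))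
  have hmeas : MeasurableSet {o : Round V nS nB | (o.payoff : ℝ) < B} :=
    measurable_payoff (.of_discrete (s := {k : ℕ | (k : ℝ) < B}))
  obtain ⟨h1, h2⟩ := weightsLaw_spec hε hc hc1 vS vB (t - 1)
  have hS : ∀ i, Measurable fun w : Weights V nS nB => ENNReal.ofReal (odds (vS i) (w.1 i)) := by
    unfold odds; fun_prop
  have hB : ∀ j, Measurable fun w : Weights V nS nB => ENNReal.ofReal (odds (vB j) (w.2 j)) := by
    unfold odds; fun_prop
  rw [repeatedLaw, Measure.bind_apply hmeas (measurable_roundLaw θ).aemeasurable]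
  calc _ ≤ ∫⁻ w, ((∑ i, ENNReal.ofReal (odds (vS i) (w.1 i)) +
          ∑ j, ENNReal.ofReal (odds (vB j) (w.2 j))) + ENNReal.ofReal (5 * θ.α))
          ∂weightsLaw θ vS vB (t - 1) := by
        refine lintegral_mono_ae ?_
        filter_upwards [h2] with w hw
        have := hw.isProbabilityMeasure_bidLaw
        exact bind_apply_le_add .of_discrete
          (fun r => (isProbabilityMeasure_mechanismLaw hε hc hc1 r).measure_univ.le)
          (G := {(vS, vB)}) .of_discrete hw.bidLaw_ne_le hmeas
          (by rintro _ rfl; exact hmech)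
    _ = _ := by
        rw [lintegral_add_right _ measurable_const,
          lintegral_add_left (Finset.measurable_sum _ fun i _ => hS i),
          lintegral_finsetSum _ fun i _ => hS i, lintegral_finsetSum _ fun j _ => hB j]
        simp

theorem isProbabilityMeasure_repeatedLaw (hV : 1 ≤ V) (hε : 0 < θ.ε)
    (hc : 0 ≤ θ.c) (hc1 : θ.c ≤ 1) (vS : Fin nS → Price V) (vB : Fin nB → Price V) (t : ℕ) :
    IsProbabilityMeasure (repeatedLaw θ vS vB t) := by
  have hne : Nonempty (Price V) := ⟨⟨1, Finset.mem_Icc.2 ⟨le_rfl, hV⟩⟩⟩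
  obtain ⟨h1, h2⟩ := weightsLaw_spec hε hc hc1 vS vB (t - 1)
  exact isProbabilityMeasure_bind (measurable_roundLaw θ)
    (h2.mono fun w hw => hw.isProbabilityMeasure_roundLaw hε hc hc1)

/-- From some round on, the shares cleared fall short of the bound with probability at most
`6 α`. -/
theorem exists_repeatedLaw_payoff_lt_le (hV : 1 ≤ V) (hε : 0 < θ.ε) (hα : 0 < θ.α)
    (hα1 : θ.α < 1) (hη : 0 < θ.η) (hξ : 0 < θ.ξ) (hc : 0 ≤ θ.c) (hc1 : θ.c ≤ 1)
    (vS : Fin nS → Price V) (vB : Fin nB → Price V) :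
    ∃ N : ℕ, 1 ≤ N ∧ ∀ t, N ≤ t →
      (repeatedLaw θ vS vB t).real {o | (o.payoff : ℝ) < opt vS vB - 2 * Real.log (V / θ.α) / θ.ε
        - 2 * Real.log (1 / θ.α) / θ.ε
        - √(6 * (opt vS vB + Real.log (1 / θ.α) / θ.ε) * Real.log (1 / θ.α))} ≤ 6 * θ.α := by
  have hne : Nonempty (Price V) := ⟨⟨1, Finset.mem_Icc.2 ⟨le_rfl, hV⟩⟩⟩
  have hlim : Tendsto (fun n => ∑ i, ∫⁻ w, ENNReal.ofReal (odds (vS i) (w.1 i))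
      ∂weightsLaw θ vS vB n + ∑ j, ∫⁻ w, ENNReal.ofReal (odds (vB j) (w.2 j))
      ∂weightsLaw θ vS vB n) atTop (𝓝 0) := by
    have h := (tendsto_finsetSum Finset.univ fun i _ =>
      tendsto_lintegral_seller_odds hε hη hξ hc hc1 vS vB i).add
      (tendsto_finsetSum Finset.univ fun j _ =>
        tendsto_lintegral_buyer_odds hε hη hξ hc hc1 vS vB j)
    simpa using h
  obtain ⟨n, hn⟩ := eventually_atTop.1
    ((tendsto_order.1 hlim).2 _ (ENNReal.ofReal_pos.2 hα))
  refine ⟨n + 1, Nat.le_add_left _ _, fun t ht => ?_⟩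
  refine ENNReal.toReal_le_of_le_ofReal (by positivity)
    ((repeatedLaw_payoff_lt_le hV hε hα hα1 hc hc1 vS vB t).trans ?_)
  rw [show 6 * θ.α = θ.α + 5 * θ.α by ring, ENNReal.ofReal_add hα.le (by positivity)]
  gcongr
  exact (hn (t - 1) (by omega)).le

end Repeated

end CallAuction

end

theorem mainTheorem11 (V nS nB : ℕ) (hV : 1 ≤ V)
    (vS : Fin nS → CallAuction.Price V) (vB : Fin nB → CallAuction.Price V)
    (ε α η ξ c : ℝ) (hε : 0 < ε) (hα : 0 < α) (hα1 : α < 1) (hη : 0 < η) (hξ : 0 < ξ)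
    (hc : 0 ≤ c) (hc1 : c ≤ 1) :
    ∃ N : ℕ, 1 ≤ N ∧ ∀ t : ℕ, N ≤ t →
      1 - 9 * α ≤ (CallAuction.repeatedLaw ⟨ε, α, η, ξ, c⟩ vS vB t).real
        {o | (CallAuction.opt vS vB : ℝ) - 2 * Real.log (V / α) / ε - 2 * Real.log (1 / α) / ε
            - √(6 * (CallAuction.opt vS vB + Real.log (1 / α) / ε) * Real.log (1 / α))
          ≤ (o.clearable : ℝ)} ∧
      1 - 9 * α ≤ (CallAuction.repeatedLaw ⟨ε, α, η, ξ, c⟩ vS vB t).real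
        {o | (CallAuction.opt vS vB : ℝ) - 2 * Real.log (V / α) / ε - 2 * Real.log (1 / α) / ε
            - √(6 * (CallAuction.opt vS vB + Real.log (1 / α) / ε) * Real.log (1 / α))
          ≤ (o.payoff : ℝ)} := by
  obtain ⟨N, hN, h⟩ := CallAuction.exists_repeatedLaw_payoff_lt_le
    (θ := ⟨ε, α, η, ξ, c⟩) hV hε hα hα1 hη hξ hc hc1 vS vB
  refine ⟨N, hN, fun t ht => ?_⟩
  have ht' := h t ht
  have := CallAuction.isProbabilityMeasure_repeatedLaw
    (θ := ⟨ε, α, η, ξ, c⟩) hV hε hc hc1 vS vB t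
  simp only at ht'
  set μ := CallAuction.repeatedLaw ⟨ε, α, η, ξ, c⟩ vS vB t
  set B : ℝ := CallAuction.opt vS vB - 2 * Real.log (V / α) / ε - 2 * Real.log (1 / α) / ε
    - √(6 * (CallAuction.opt vS vB + Real.log (1 / α) / ε) * Real.log (1 / α))
  have hpay : 1 - 9 * α ≤ μ.real {o | B ≤ (o.payoff : ℝ)} := by
    have hu : (1 : ℝ) ≤ μ.real {o | B ≤ (o.payoff : ℝ)} + μ.real {o | (o.payoff : ℝ) < B} := by
      rw [← probReal_univ (μ := μ)]
      refine (measureReal_mono fun o _ => ?_).trans (measureReal_union_le _ _)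
      exact le_or_gt B (o.payoff : ℝ)
    linarith
  refine ⟨hpay.trans (measureReal_mono fun o ho => ?_), hpay⟩
  exact le_trans (show B ≤ (o.payoff : ℝ) from ho) (by exact_mod_cast o.payoff_le_clearable)
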